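/- All graphs are finite, simple and undirected. A set $S\subseteq V(G)$ is a cutset of $G$ if $G-S$ is disconnected, i.e. has at least two components; an independent cutset is a cutset that is an independent set. Independent Cutset is the problem: given a connected graph $G$, decide whether $G$ has an independent cutset (and return one if so). For an integer $c\ge 0$, an $\alpha_c$-dominating set of $G$ is a dominating set $X$ of $G$ with $\alpha(G[X])\le c$, where $\alpha$ is the independence number. A class $\mathcal G$ of graphs (closed under isomorphism) is efficiently $\alpha_c$-dominated if some algorithm computes, for every $G\in\mathcal G$, an $\alpha_c$-dominating set of $G$ in time polynomial in $|V(G)|$. Running time $\mathcal O^*(f(k))$ means running time at most $f(k)\cdot p(n)$ for a polynomial $p$, where $n$ is the number of vertices of the input graph. Algorithms are programs of a WHILE language on binary trees with unit cost per elementary pointer operation; graphs are given by adjacency matrices. **Theorem.** Let $c\ge 0$ be a fixed integer and let $\mathcal G$ be an efficiently $\alpha_c$-dominated class of graphs. (1) Let $f:\mathbb N\to\mathbb R$, and let $\mathcal I$ be any collection of pairs $(G,k)$, where $G$ is a connected graph and $k\ge 0$ is an integer. Suppose that some algorithm finds, for every $(G,k)\in\mathcal I$, a set $X$ of at most $k$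 vertices of $G$ with $G-X\in\mathcal G$, in $\mathcal O^*(f(k))$ time. Then Independent Cutset can be solved for all $(G,k)\in\mathcal I$ in $\mathcal O^*(f(k)+3^k)$ time. This holds both when $k$ is given to the two algorithms along with $G$, and when their input is $G$ alone. (2) Independent Cutset on connected graphs of $\mathcal G$ can be solved in polynomial time. -/

import Mathlib

namespace ICut

/-! ### Machine model

A small LISP-like language (a WHILE language over binary trees).  A program transforms one value.
Values are to be thought of as pointers to shared, immutable cons cells, so each elementary
operation is a constant number of pointer operations and costs one time unit; arithmetic,
comparison of values, random access, etc. have to be programmed. -/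

/-- Data values: binary trees. -/
inductive Val : Type
  | nil : Val
  | node : Val → Val → Val

/-- Left component (`nil` for `nil`). -/
def Val.left : Val → Val
  | .nil => .nil
  | .node a _ => a

/-- Right component (`nil` for `nil`). -/
def Val.right : Val → Val
  | .nil => .nil
  | .node _ b => b

/-- Programs. -/
inductive Prog : Type
  /-- return the input -/
  | skip : Prog
  /-- return `nil` -/
  | nil : Prog
  /-- return the left component of the input -/
  | left : Prog
  /-- return the right component of the input -/
  | right : Prog
  /-- run both programs on the input and return the pair of the two results -/
  | cons : Prog → Prog → Prog
  /-- run the first program, then the second one on its result -/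
  | seq : Prog → Prog → Prog
  /-- `ite b p q`: run the test `b` on the input; run `p` on the input if the result of the test
  is not `nil`, and `q` on the input otherwise -/
  | ite : Prog → Prog → Prog → Prog
  /-- `loop b p`: as long as the test `b` does not return `nil` on the current value, replace
  the current value by the result of `p` on it -/
  | loop : Prog → Prog → Prog

/-- `Run p v w t`: on input `v`, the program `p` halts after exactly `t` time units with
result `w`. -/
inductive Run : Prog → Val → Val → ℕ → Prop
  | skip (v : Val) : Run .skip v v 1
  | nil (v : Val) : Run .nil v .nil 1
  | left (v : Val) : Run .left v v.left 1
  | right (v : Val) : Run .right v v.right 1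
  | cons {p q : Prog} {v a b : Val} {s t : ℕ} :
      Run p v a s → Run q v b t → Run (.cons p q) v (.node a b) (s + t + 1)
  | seq {p q : Prog} {v w u : Val} {s t : ℕ} :
      Run p v w s → Run q w u t → Run (.seq p q) v u (s + t + 1)
  | ite_true {b p q : Prog} {v x y w : Val} {s t : ℕ} :
      Run b v (.node x y) s → Run p v w t → Run (.ite b p q) v w (s + t + 1)
  | ite_false {b p q : Prog} {v w : Val} {s t : ℕ} :
      Run b v .nil s → Run q v w t → Run (.ite b p q) v w (s + t + 1)
  | loop_done {b p : Prog} {v : Val} {s : ℕ} :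
      Run b v .nil s → Run (.loop b p) v v (s + 1)
  | loop_step {b p : Prog} {v x y w u : Val} {r s t : ℕ} :
      Run b v (.node x y) r → Run p v w s → Run (.loop b p) w u t →
        Run (.loop b p) v u (r + s + t + 1)

/-! ### Encodings of numbers, graphs, vertex sets -/

/-- Unary encoding of natural numbers. -/
def encNat : ℕ → Val
  | 0 => .nil
  | k + 1 => .node .nil (encNat k)

/-- Truth values: `nil` is false, `(nil, nil)` is true. -/
def encBool (b : Bool) : Val :=
  if b then .node .nil .nil else .nil

/-- Lists of values. -/
def encList : List Val → Val
  | [] => .nil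
  | a :: l => .node a (encList l)

open Classical in
/-- A vertex set is given by its characteristic vector. -/
noncomputable def encSet {n : ℕ} (S : Finset (Fin n)) : Val :=
  encList (List.ofFn fun i => encBool (decide (i ∈ S)))

open Classical in
/-- A graph is given by its adjacency matrix, a list of rows. -/
noncomputable def encGraph {n : ℕ} (G : SimpleGraph (Fin n)) : Val :=
  encList (List.ofFn fun i => encList (List.ofFn fun j => encBool (decide (G.Adj i j))))

/-- An answer of a search algorithm: `nil` for "there is none", and `(nil, S)` for a set `S`. -/
noncomputable def encAnswer {n : ℕ} : Option (Finset (Fin n)) → Val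
  | none => .nil
  | some S => .node .nil (encSet S)

/-! ### Graph notions -/

/-- `S` is a cutset of `G` if `G - S` is disconnected, that is, some two of its vertices
lie in different components. -/
def IsCutset {V : Type*} (G : SimpleGraph V) (S : Set V) : Prop :=
  ¬ (G.induce Sᶜ).Preconnected

/-- Independent cutsets. -/
def IsIndepCutset {V : Type*} (G : SimpleGraph V) (S : Set V) : Prop :=
  G.IsIndepSet S ∧ IsCutset G S

/-- Dominating sets. -/
def IsDominatingSet {V : Type*} (G : SimpleGraph V) (X : Set V) : Prop :=
  ∀ v, v ∈ X ∨ ∃ u ∈ X, G.Adj v u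

/-- `X` is an `α_c`-dominating set of `G`: it is dominating and `α(G[X]) ≤ c`. -/
def IsAlphaDominatingSet {V : Type*} (c : ℕ) (G : SimpleGraph V) (X : Set V) : Prop :=
  IsDominatingSet G X ∧ (G.induce X).indepNum ≤ c

/-- A class of finite graphs: a set of graphs on the vertex sets `Fin n`, closed under
isomorphism. -/
structure GraphClass where
  /-- the graphs on `Fin n` in the class -/
  mem : ∀ n : ℕ, SimpleGraph (Fin n) → Prop
  iso_closed : ∀ {m n : ℕ} (G : SimpleGraph (Fin m)) (H : SimpleGraph (Fin n)),
    Nonempty (G ≃g H) → mem m G → mem n H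

/-- A graph on any vertex type belongs to the class if it is isomorphic to one of the
graphs of the class. -/
def GraphClass.Contains (𝒢 : GraphClass) {V : Type*} (G : SimpleGraph V) : Prop :=
  ∃ (m : ℕ) (H : SimpleGraph (Fin m)), 𝒢.mem m H ∧ Nonempty (G ≃g H)

/-- The class is efficiently `α_c`-dominated: some program computes an `α_c`-dominating set
of every graph of the class in time polynomial in the number of vertices. -/
def GraphClass.EfficientlyAlphaDominated (𝒢 : GraphClass) (c : ℕ) : Prop :=
  ∃ (D : Prog) (p : Polynomial ℕ), ∀ (n : ℕ) (G : SimpleGraph (Fin n)), 𝒢.mem n G →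
    ∃ (X : Finset (Fin n)) (t : ℕ), IsAlphaDominatingSet c G (X : Set (Fin n)) ∧
      Run D (encGraph G) (encSet X) t ∧ t ≤ p.eval n

/-! ### Computational problems

`I n G k` says that the graph `G` on `n` vertices with parameter value `k` is an instance, and
`inp` is the encoding under which instances are presented to the programs. -/

/-- A way of presenting graphs with a parameter to a program. -/
abbrev Presentation := ∀ n : ℕ, SimpleGraph (Fin n) → ℕ → Val

/-- The input is the graph alone. -/
noncomputable def graphOnly : Presentation := fun _ G _ => encGraph G

/-- The input is the graph together with the value of the parameter. -/
noncomputable def graphAndParam : Presentation := fun _ G k => .node (encGraph G) (encNat k)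

/-- In time `O*(f(k))`, i.e. `f(k)` times a polynomial in the number of vertices, some program
finds for each instance `(G, k)` a set `X` of at most `k` vertices with `G - X` in `𝒢`. -/
def DeletionSetFound (inp : Presentation) (I : ∀ n : ℕ, SimpleGraph (Fin n) → ℕ → Prop)
    (𝒢 : GraphClass) (f : ℕ → ℝ) : Prop :=
  ∃ (A : Prog) (p : Polynomial ℕ), ∀ (n : ℕ) (G : SimpleGraph (Fin n)) (k : ℕ), I n G k →
    ∃ (X : Finset (Fin n)) (t : ℕ),
      X.card ≤ k ∧ 𝒢.Contains (G.induce ((X : Set (Fin n))ᶜ)) ∧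
      Run A (inp n G k) (encSet X) t ∧ (t : ℝ) ≤ f k * ((p.eval n : ℕ) : ℝ)

/-- `o` is a correct answer to the question for an independent cutset of `G`: either an
independent cutset, or `none` if `G` has no independent cutset. -/
def IsCorrectAnswer {n : ℕ} (G : SimpleGraph (Fin n)) : Option (Finset (Fin n)) → Prop
  | none => ¬ ∃ S : Set (Fin n), IsIndepCutset G S
  | some S => IsIndepCutset G (S : Set (Fin n))

/-- In time `O*(f(k))`, some program decides for each instance `(G, k)` whether `G` has an
independent cutset, and returns one in the affirmative case. -/
def IndepCutsetSolved (inp : Presentation) (I : ∀ n : ℕ, SimpleGraph (Fin n) → ℕ → Prop)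
    (f : ℕ → ℝ) : Prop :=
  ∃ (B : Prog) (p : Polynomial ℕ), ∀ (n : ℕ) (G : SimpleGraph (Fin n)) (k : ℕ), I n G k →
    ∃ (o : Option (Finset (Fin n))) (t : ℕ), IsCorrectAnswer G o ∧
      Run B (inp n G k) (encAnswer o) t ∧ (t : ℝ) ≤ f k * ((p.eval n : ℕ) : ℝ)

/-- Independent Cutset on the (connected) graphs of the class is solved in polynomial time. -/
def IndepCutsetPolyTimeOn (𝒢 : GraphClass) : Prop :=
  ∃ (B : Prog) (p : Polynomial ℕ), ∀ (n : ℕ) (G : SimpleGraph (Fin n)),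
    𝒢.mem n G → G.Connected →
      ∃ (o : Option (Finset (Fin n))) (t : ℕ), IsCorrectAnswer G o ∧
        Run B (encGraph G) (encAnswer o) t ∧ t ≤ p.eval n

end ICut

/-!
A graph has an independent cutset if and only if its vertices can be labelled with `0`, `1`, `2`
(one side, cutset, other side) such that `0` and `2` both occur and no edge has end labels with
sum `2`.  Labellings are searched for by constraint propagation on sets of admissible labels
(`prune`, `propagate`).

If the labels of a dominating set are fixed, every other vertex keeps at most two admissible labels
(`exists_not_of_dominating`), and the rest is an instance of 2-SAT.  It is solved by limited
backtracking: a choice that survives propagation never has to be revised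
(`exists_labelling_assign`).

Let `X` be a set with `G - X` in the class, and `Y` an `α_c`-dominating set of `G - X`.  Then `X ∪ Y`
dominates `G`.  Its vertices are labelled one after the other in all ways that survive propagation
(`branches`).  At most `3 ^ |X|` times a polynomial number of partial labellings are alive at any
time, because on `Y` a labelling is determined by two independent subsets of `Y`, with at most `c`
elements each: the vertices in the cutset, and a maximal independent subset of the vertices on the
first side (`card_partial_labellings_le`, `length_branches_le`).  For each branch, all pairs of a
vertex `a` on the first and a vertex `b` on the second side are tried (`search`).

The running times are controlled by a small calculus: `PolyTime e sz Γ a` says that one program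
computes `a i` from the context `Γ i` in time `3 ^ e i` times a polynomial in `sz i`, uniformly in
the index `i` of the instance.  Vertices are represented in unary, vectors and matrices are
accessed by position, and the formation rules (composition, case distinction, quantification over a
range, tabulation, folds) let each step of the algorithm be written as an expression in the
variables in scope.  Only the list of branches has exponential length, and it is only traversed
sequentially (`PolyTime.foldl_list`).
-/

namespace ICut

/-! ### Programs with time bounds -/

theorem eval_nat_mono (P : Polynomial ℕ) {a b : ℕ} (h : a ≤ b) : P.eval a ≤ P.eval b := by
  rw [Polynomial.eval_eq_sum_range, Polynomial.eval_eq_sum_range]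
  gcongr

/-- `N` is bounded by a polynomial in `sz`. -/
def PolyBdd {ι : Type} (sz N : ι → ℕ) : Prop :=
  ∃ P : Polynomial ℕ, ∀ i, N i ≤ P.eval (sz i)

theorem PolyBdd.of_le {ι : Type} {sz N : ι → ℕ} (h : ∀ i, N i ≤ sz i) : PolyBdd sz N :=
  ⟨Polynomial.X, fun i => by simpa using h i⟩

theorem PolyBdd.const {ι : Type} (sz : ι → ℕ) (m : ℕ) : PolyBdd sz fun _ => m :=
  ⟨Polynomial.C m, fun i => by simp⟩

/-- For a family of instances indexed by `ι`, one program transforms `Γ i` into `a i` for all `i`,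
in time at most `3 ^ e i` times a polynomial in `sz i`.  Here `Γ i` plays the role of a context,
a tuple of the values of the variables in scope, and `a i` is the value of an expression in these
variables; the lemmas below are the formation rules for such expressions. -/
def PolyTime {ι : Type} (e sz : ι → ℕ) (Γ a : ι → Val) : Prop :=
  ∃ (p : Prog) (P : Polynomial ℕ), ∀ i, ∃ t, Run p (Γ i) (a i) t ∧ t ≤ 3 ^ e i * P.eval (sz i)

/-- Truth values of propositions. -/
noncomputable def encProp (P : Prop) : Val :=
  open Classical in encBool (decide P)

theorem encProp_true {P : Prop} (h : P) : encProp P = .node .nil .nil := by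
  simp [encProp, encBool, h]

theorem encProp_false {P : Prop} (h : ¬ P) : encProp P = .nil := by
  simp [encProp, encBool, h]

namespace PolyTime

variable {ι : Type} {e sz : ι → ℕ} {Γ a b : ι → Val} {P Q : ι → Prop}

theorem congr (h : PolyTime e sz Γ a) (hab : ∀ i, b i = a i) : PolyTime e sz Γ b := by
  rwa [show b = a from funext hab]

theorem mono {e' : ι → ℕ} (h : PolyTime e sz Γ a) (he : ∀ i, e i ≤ e' i) :
    PolyTime e' sz Γ a := by
  obtain ⟨p, P, hp⟩ := h
  refine ⟨p, P, fun i => ?_⟩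
  obtain ⟨t, ht, hb⟩ := hp i
  exact ⟨t, ht, hb.trans (Nat.mul_le_mul_right _ (Nat.pow_le_pow_right (by norm_num) (he i)))⟩

theorem of_unit (p : Prog) (h : ∀ i, Run p (Γ i) (a i) 1) : PolyTime e sz Γ a :=
  ⟨p, 1, fun i => ⟨1, h i, by simpa using Nat.one_le_pow _ _ (by norm_num)⟩⟩

theorem var : PolyTime e sz Γ Γ := of_unit .skip fun _ => .skip _

theorem nil : PolyTime e sz Γ fun _ => Val.nil := of_unit .nil fun _ => .nil _

/-- Composition: calling a procedure for a family of instances indexed by `κ`. -/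
theorem comp {κ : Type} {e' sz' : κ → ℕ} {Δ c : κ → Val} (h : PolyTime e' sz' Δ c) (φ : ι → κ)
    (he : ∀ i, e' (φ i) ≤ e i) (hsz : PolyBdd sz fun i => sz' (φ i))
    (ha : PolyTime e sz Γ fun i => Δ (φ i)) : PolyTime e sz Γ fun i => c (φ i) := by
  obtain ⟨p, P, hp⟩ := ha
  obtain ⟨q, Q, hq⟩ := h
  obtain ⟨R, hR⟩ := hsz
  refine ⟨.seq p q, P + Q.comp R + 1, fun i => ?_⟩
  obtain ⟨s, hs, hsb⟩ := hp i
  obtain ⟨t, ht, htb⟩ := hq (φ i)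
  refine ⟨_, .seq hs ht, ?_⟩
  have h1 : 1 ≤ 3 ^ e i := Nat.one_le_pow _ _ (by norm_num)
  have h2 : t ≤ 3 ^ e i * Q.eval (R.eval (sz i)) :=
    htb.trans (Nat.mul_le_mul (Nat.pow_le_pow_right (by norm_num) (he i)) (eval_nat_mono Q (hR i)))
  simp only [Polynomial.eval_add, Polynomial.eval_comp, Polynomial.eval_one, mul_add, mul_one]
  omega

theorem seq (ha : PolyTime e sz Γ a) (hb : PolyTime e sz a b) : PolyTime e sz Γ b :=
  hb.comp id (fun _ => le_rfl) (.of_le fun _ => le_rfl) ha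

/-- Passing from a context to a larger one. -/
theorem lift {κ : Type} {Δ : κ → Val} (h : PolyTime e sz Γ a) (π : κ → ι)
    (hΔ : PolyTime (fun x => e (π x)) (fun x => sz (π x)) Δ fun x => Γ (π x)) :
    PolyTime (fun x => e (π x)) (fun x => sz (π x)) Δ fun x => a (π x) :=
  h.comp π (fun _ => le_rfl) (.of_le fun _ => le_rfl) hΔ

theorem left (h : PolyTime e sz Γ a) : PolyTime e sz Γ fun i => (a i).left :=
  h.seq (of_unit .left fun _ => .left _)

theorem right (h : PolyTime e sz Γ a) : PolyTime e sz Γ fun i => (a i).right :=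
  h.seq (of_unit .right fun _ => .right _)

theorem pair (ha : PolyTime e sz Γ a) (hb : PolyTime e sz Γ b) :
    PolyTime e sz Γ fun i => .node (a i) (b i) := by
  obtain ⟨p, P, hp⟩ := ha
  obtain ⟨q, Q, hq⟩ := hb
  refine ⟨.cons p q, P + Q + 1, fun i => ?_⟩
  obtain ⟨s, hs, hsb⟩ := hp i
  obtain ⟨t, ht, htb⟩ := hq i
  refine ⟨_, .cons hs ht, ?_⟩
  have h1 : 1 ≤ 3 ^ e i := Nat.one_le_pow _ _ (by norm_num)
  simp only [Polynomial.eval_add, Polynomial.eval_one, mul_add, mul_one]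
  omega

/-- Case distinction according to whether a value is `nil`. -/
theorem ite_nil {c : ι → Val} (hc : PolyTime e sz Γ c) (ha : PolyTime e sz Γ a)
    (hb : PolyTime e sz Γ b) {d : ι → Val} (hd : ∀ i, c i ≠ .nil → d i = a i)
    (hd' : ∀ i, c i = .nil → d i = b i) : PolyTime e sz Γ d := by
  obtain ⟨r, R, hr⟩ := hc
  obtain ⟨p, P, hp⟩ := ha
  obtain ⟨q, Q, hq⟩ := hb
  refine ⟨.ite r p q, R + P + Q + 1, fun i => ?_⟩
  obtain ⟨u, hu, hub⟩ := hr i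
  obtain ⟨s, hs, hsb⟩ := hp i
  obtain ⟨t, ht, htb⟩ := hq i
  have h1 : 1 ≤ 3 ^ e i := Nat.one_le_pow _ _ (by norm_num)
  simp only [Polynomial.eval_add, Polynomial.eval_one, mul_add, mul_one]
  cases hci : c i with
  | nil =>
    rw [hd' i hci]
    exact ⟨_, .ite_false (hci ▸ hu) ht, by omega⟩
  | node x y =>
    rw [hd i (by simp [hci])]
    exact ⟨_, .ite_true (hci ▸ hu) hs, by omega⟩

open Classical in
theorem ite (hP : PolyTime e sz Γ fun i => encProp (P i)) (ha : PolyTime e sz Γ a)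
    (hb : PolyTime e sz Γ b) : PolyTime e sz Γ fun i => if P i then a i else b i := by
  refine ite_nil hP ha hb (fun i h => ?_) fun i h => ?_
  · exact if_pos (by_contra fun h' => h (encProp_false h'))
  · exact if_neg fun h' => by simp [encProp_true h'] at h

theorem tt : PolyTime e sz Γ fun _ => encProp True :=
  (nil.pair nil).congr fun _ => encProp_true trivial

theorem ff : PolyTime e sz Γ fun _ => encProp False :=
  nil.congr fun _ => encProp_false id

theorem prop_ite {R : ι → Prop} (hP : PolyTime e sz Γ fun i => encProp (P i))
    (hQ : PolyTime e sz Γ fun i => encProp (Q i)) (hR : PolyTime e sz Γ fun i => encProp (R i))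
    {S : ι → Prop} (hS : ∀ i, P i → (S i ↔ Q i)) (hS' : ∀ i, ¬ P i → (S i ↔ R i)) :
    PolyTime e sz Γ fun i => encProp (S i) := by
  classical
  refine (ite hP hQ hR).congr fun i => ?_
  split_ifs with h
  · rw [hS i h]
  · rw [hS' i h]

theorem prop_not (hP : PolyTime e sz Γ fun i => encProp (P i)) :
    PolyTime e sz Γ fun i => encProp (¬ P i) :=
  prop_ite hP ff tt (by simp) (by simp)

theorem prop_and (hP : PolyTime e sz Γ fun i => encProp (P i))
    (hQ : PolyTime e sz Γ fun i => encProp (Q i)) :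
    PolyTime e sz Γ fun i => encProp (P i ∧ Q i) :=
  prop_ite hP hQ ff (by simp +contextual) (by simp +contextual)

theorem prop_or (hP : PolyTime e sz Γ fun i => encProp (P i))
    (hQ : PolyTime e sz Γ fun i => encProp (Q i)) :
    PolyTime e sz Γ fun i => encProp (P i ∨ Q i) :=
  prop_ite hP tt hQ (by simp +contextual) (by simp +contextual)

theorem prop_imp (hP : PolyTime e sz Γ fun i => encProp (P i))
    (hQ : PolyTime e sz Γ fun i => encProp (Q i)) :
    PolyTime e sz Γ fun i => encProp (P i → Q i) :=
  prop_ite hP hQ tt (by simp +contextual) (by simp +contextual)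

theorem isNil (ha : PolyTime e sz Γ a) : PolyTime e sz Γ fun i => encProp (a i = .nil) :=
  ite_nil ha ff tt (fun i h => by simp [h]) (fun i h => by simp [h])

theorem nat_const (m : ℕ) : PolyTime e sz Γ fun _ => encNat m := by
  induction m with
  | zero => exact nil
  | succ m ih => exact nil.pair ih

/-- A loop that runs through the values `s i 0, …, s i (N i)`. -/
theorem while_loop {N : ι → ℕ} (s τ : ι → ℕ → Val) {e₁ e₂ : ι → ℕ}
    (hN : ∃ Q : Polynomial ℕ, ∀ i, N i ≤ 3 ^ e₁ i * Q.eval (sz i))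
    (he : ∀ i, e₁ i + e₂ i ≤ e i)
    (htest : PolyTime (ι := Σ i, Fin (N i + 1)) (fun x => e₂ x.1) (fun x => sz x.1)
      (fun x => s x.1 x.2) (fun x => τ x.1 x.2))
    (hτ : ∀ i j, j < N i → τ i j ≠ .nil) (hτ' : ∀ i, τ i (N i) = .nil)
    (hbody : PolyTime (ι := Σ i, Fin (N i)) (fun x => e₂ x.1) (fun x => sz x.1)
      (fun x => s x.1 x.2) (fun x => s x.1 (x.2 + 1))) :
    PolyTime e sz (fun i => s i 0) (fun i => s i (N i)) := by
  obtain ⟨Q, hQ⟩ := hN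
  obtain ⟨p, P, hp⟩ := htest
  obtain ⟨q, R, hq⟩ := hbody
  refine ⟨.loop p q, (Q + 1) * (P + R + 1), fun i => ?_⟩
  set T := 3 ^ e₂ i * (P.eval (sz i) + R.eval (sz i) + 1) with hT
  have h1 : 1 ≤ 3 ^ e₂ i := Nat.one_le_pow _ _ (by norm_num)
  have key : ∀ m j, j + m = N i → ∃ t, Run (.loop p q) (s i j) (s i (N i)) t ∧
      t ≤ (m + 1) * T := by
    intro m
    induction m with
    | zero =>
      intro j hj
      obtain rfl : j = N i := by omega
      obtain ⟨t, ht, hb⟩ := hp ⟨i, ⟨N i, by omega⟩⟩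
      simp only [hτ'] at ht
      refine ⟨_, .loop_done ht, ?_⟩
      simp only [hT, mul_add, mul_one, one_mul, zero_add] at hb ⊢
      omega
    | succ m ih =>
      intro j hj
      obtain ⟨t, ht, hb⟩ := hp ⟨i, ⟨j, by omega⟩⟩
      obtain ⟨u, hu, hub⟩ := hq ⟨i, ⟨j, by omega⟩⟩
      obtain ⟨r, hr, hrb⟩ := ih (j + 1) (by omega)
      cases hv : τ i j with
      | nil => exact absurd hv (hτ i j (by omega))
      | node x y =>
        simp only [hv] at ht
        refine ⟨_, .loop_step ht hu hr, ?_⟩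
        have : (m + 1 + 1) * T = (m + 1) * T + T := by ring
        rw [this]
        simp only [hT, mul_add, mul_one] at hb hub hrb ⊢
        omega
  obtain ⟨t, ht, hb⟩ := key (N i) 0 (by omega)
  refine ⟨t, ht, hb.trans ?_⟩
  have h2 : N i + 1 ≤ 3 ^ e₁ i * (Q.eval (sz i) + 1) := by
    have := hQ i
    have : 1 ≤ 3 ^ e₁ i := Nat.one_le_pow _ _ (by norm_num)
    rw [mul_add]; omega
  calc (N i + 1) * T ≤ 3 ^ e₁ i * (Q.eval (sz i) + 1) * T := Nat.mul_le_mul_right _ h2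
    _ = 3 ^ (e₁ i + e₂ i) * ((Q.eval (sz i) + 1) * (P.eval (sz i) + R.eval (sz i) + 1)) := by
      rw [hT, pow_add]; ring
    _ ≤ _ := by
      simp only [Polynomial.eval_mul, Polynomial.eval_add, Polynomial.eval_one]
      exact Nat.mul_le_mul_right _ (Nat.pow_le_pow_right (by norm_num) (he i))

/-- A loop in which a counter runs from `N i - 1` down to `0`; `st i j` is the state before the
counter takes the value `j - 1`. -/
theorem down_loop {N : ι → ℕ} (st : ι → ℕ → Val) (hN : PolyBdd sz N)
    (hn : PolyTime e sz Γ fun i => encNat (N i)) (h0 : PolyTime e sz Γ fun i => st i (N i))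
    (hstep : PolyTime (ι := Σ i, Fin (N i)) (fun x => e x.1) (fun x => sz x.1)
      (fun x => .node (encNat x.2) (.node (st x.1 (x.2 + 1)) (Γ x.1))) (fun x => st x.1 x.2)) :
    PolyTime e sz Γ fun i => st i 0 := by
  obtain ⟨Q, hQ⟩ := hN
  have hloop : PolyTime e sz (fun i => .node (encNat (N i)) (.node (st i (N i)) (Γ i)))
      (fun i => .node (encNat (N i - N i)) (.node (st i (N i - N i)) (Γ i))) := by
    refine while_loop
      (fun i j => .node (encNat (N i - j)) (.node (st i (N i - j)) (Γ i)))
      (fun i j => encNat (N i - j)) (e₁ := fun _ => 0) ⟨Q, by simpa using hQ⟩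
      (fun i => (Nat.zero_add _).le) var.left ?_ (by simp [encNat]) ?_
    · intro i j hj h
      obtain ⟨m, hm⟩ : ∃ m, N i - j = m + 1 := ⟨N i - j - 1, by omega⟩
      simp [hm, encNat] at h
    · have hr : ∀ x : Σ i, Fin (N i),
          encNat (N x.1 - (x.2 + 1)) = (encNat (N x.1 - x.2)).right := by
        rintro ⟨i, j, hj⟩
        simp only
        rw [show N i - j = N i - (j + 1) + 1 by omega]
        rfl
      have hc : PolyTime (ι := Σ i, Fin (N i)) (fun x => e x.1) (fun x => sz x.1)
          (fun x => .node (encNat (N x.1 - x.2)) (.node (st x.1 (N x.1 - x.2)) (Γ x.1)))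
          (fun x => encNat (N x.1 - (x.2 + 1))) := var.left.right.congr hr
      refine hc.pair (pair ?_ var.right.right)
      refine hstep.comp
        (fun x : Σ i, Fin (N i) => (⟨x.1, ⟨N x.1 - (x.2 + 1), by have := x.2.2; omega⟩⟩ :
          Σ i, Fin (N i)))
        (fun _ => le_rfl) (.of_le fun _ => le_rfl) (hc.pair (pair ?_ var.right.right))
      refine var.right.left.congr fun x => ?_
      have := x.2.2
      exact congrArg (st x.1) (by simp only; omega)
  exact ((hn.pair (h0.pair var)).seq hloop).right.left.congr fun i => by simp [Val.left, Val.right]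

/-- A fold over the numbers below `N i`. -/
theorem foldr_fin {N : ι → ℕ} {σ : ι → Type} (es : ∀ i, σ i → Val)
    (f : ∀ i, Fin (N i) → σ i → σ i) {s₀ : ∀ i, σ i} (hN : PolyBdd sz N)
    (hn : PolyTime e sz Γ fun i => encNat (N i)) (h0 : PolyTime e sz Γ fun i => es i (s₀ i))
    (hstep : PolyTime (ι := Σ i, Fin (N i) × σ i) (fun x => e x.1) (fun x => sz x.1)
      (fun x => .node (encNat x.2.1) (.node (es x.1 x.2.2) (Γ x.1)))
      (fun x => es x.1 (f x.1 x.2.1 x.2.2))) :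
    PolyTime e sz Γ fun i => es i ((List.finRange (N i)).foldr (f i) (s₀ i)) := by
  refine (down_loop (Γ := Γ) (fun i k => es i (((List.finRange (N i)).drop k).foldr (f i) (s₀ i)))
    hN hn (h0.congr fun i => ?_) ?_).congr fun i => by simp
  · rw [List.drop_eq_nil_of_le (by simp)]
    rfl
  refine (hstep.comp
    (fun x : Σ i, Fin (N i) => ⟨x.1, x.2, ((List.finRange (N x.1)).drop (x.2 + 1)).foldr (f x.1)
      (s₀ x.1)⟩) (fun _ => le_rfl) (.of_le fun _ => le_rfl) var).congr ?_
  rintro ⟨i, j⟩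
  simp only
  rw [List.drop_eq_getElem_cons (l := List.finRange (N i)) (i := j) (by simp)]
  simp

theorem prop_forall {N : ι → ℕ} {R : ∀ i, Fin (N i) → Prop} (hN : PolyBdd sz N)
    (hn : PolyTime e sz Γ fun i => encNat (N i))
    (hstep : PolyTime (ι := Σ i, Fin (N i)) (fun x => e x.1) (fun x => sz x.1)
      (fun x => .node (encNat x.2) (Γ x.1)) (fun x => encProp (R x.1 x.2))) :
    PolyTime e sz Γ fun i => encProp (∀ j, R i j) := by
  refine (foldr_fin (Γ := Γ) (σ := fun _ => Prop) (fun _ => encProp) (fun i j p => R i j ∧ p)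
    (s₀ := fun _ => True) hN hn tt ?_).congr ?_
  · exact prop_and (hstep.lift (fun x : Σ i, Fin (N i) × Prop => (⟨x.1, x.2.1⟩ : Σ i, Fin (N i)))
      (var.left.pair var.right.right)) var.right.left
  · intro i
    congr 1
    have : ∀ l : List (Fin (N i)), l.foldr (fun j p => R i j ∧ p) True ↔ ∀ j ∈ l, R i j := by
      intro l
      induction l <;> simp_all
    simp [this]

theorem prop_exists {N : ι → ℕ} {R : ∀ i, Fin (N i) → Prop} (hN : PolyBdd sz N)
    (hn : PolyTime e sz Γ fun i => encNat (N i))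
    (hstep : PolyTime (ι := Σ i, Fin (N i)) (fun x => e x.1) (fun x => sz x.1)
      (fun x => .node (encNat x.2) (Γ x.1)) (fun x => encProp (R x.1 x.2))) :
    PolyTime e sz Γ fun i => encProp (∃ j, R i j) :=
  (prop_not (prop_forall (R := fun i j => ¬ R i j) hN hn (prop_not hstep))).congr fun i => by simp

theorem ofFn {N : ι → ℕ} {g : ∀ i, Fin (N i) → Val} (hN : PolyBdd sz N)
    (hn : PolyTime e sz Γ fun i => encNat (N i))
    (hstep : PolyTime (ι := Σ i, Fin (N i)) (fun x => e x.1) (fun x => sz x.1)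
      (fun x => .node (encNat x.2) (Γ x.1)) (fun x => g x.1 x.2)) :
    PolyTime e sz Γ fun i => encList (List.ofFn (g i)) := by
  refine (foldr_fin (Γ := Γ) (σ := fun _ => List Val) (fun _ => encList) (fun i j l => g i j :: l)
    (s₀ := fun _ => []) hN hn nil ?_).congr ?_
  · exact pair (hstep.lift
      (fun x : Σ i, Fin (N i) × List Val => (⟨x.1, x.2.1⟩ : Σ i, Fin (N i)))
      (var.left.pair var.right.right)) var.right.left
  · intro i
    rw [List.ofFn_eq_map]
    congr 1
    induction List.finRange (N i) <;> simp_all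

/-- Discarding the first entries of a list. -/
theorem drop {l : ι → List Val} {k : ι → ℕ} (hk : PolyBdd sz k)
    (hl : PolyTime e sz Γ fun i => encList (l i)) (hn : PolyTime e sz Γ fun i => encNat (k i)) :
    PolyTime e sz Γ fun i => encList ((l i).drop (k i)) := by
  refine (down_loop (Γ := Γ) (fun i j => encList ((l i).drop (k i - j))) hk hn
    (hl.congr (by simp)) ?_).congr (by simp)
  refine var.right.left.right.congr ?_
  rintro ⟨i, j⟩
  have : k i - j = (k i - (j + 1)) + 1 := by omega
  simp only [Val.left, Val.right]
  rw [this, ← List.drop_drop]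
  cases (l i).drop (k i - (j + 1)) <;> rfl

theorem get_ofFn {N : ι → ℕ} {g : ∀ i, Fin (N i) → Val} {k : ∀ i, Fin (N i)} (hN : PolyBdd sz N)
    (hl : PolyTime e sz Γ fun i => encList (List.ofFn (g i)))
    (hn : PolyTime e sz Γ fun i => encNat (k i)) : PolyTime e sz Γ fun i => g i (k i) := by
  have hk : PolyBdd sz fun i => (k i : ℕ) := hN.imp fun P h i => (k i).2.le.trans (h i)
  refine (drop hk hl hn).left.congr fun i => ?_
  rw [List.drop_eq_getElem_cons (by simp)]
  simp [encList, Val.left]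

theorem encNat_eq_encList (m : ℕ) : encNat m = encList (List.replicate m .nil) := by
  induction m with
  | zero => rfl
  | succ m ih => simp [encNat, List.replicate_succ, encList, ih]

theorem nat_le {k m : ι → ℕ} (hb : PolyBdd sz m) (hk : PolyTime e sz Γ fun i => encNat (k i))
    (hm : PolyTime e sz Γ fun i => encNat (m i)) :
    PolyTime e sz Γ fun i => encProp (k i ≤ m i) := by
  refine (isNil (drop (l := fun i => List.replicate (k i) .nil) hb
    (hk.congr fun i => (encNat_eq_encList _).symm) hm)).congr fun i => ?_
  congr 1
  rw [List.drop_replicate, ← encNat_eq_encList]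
  rcases hd : k i - m i with _ | r
  · simp [encNat]; omega
  · simp [encNat]; omega

theorem nat_eq {k m : ι → ℕ} (hbk : PolyBdd sz k) (hbm : PolyBdd sz m)
    (hk : PolyTime e sz Γ fun i => encNat (k i)) (hm : PolyTime e sz Γ fun i => encNat (m i)) :
    PolyTime e sz Γ fun i => encProp (k i = m i) :=
  (prop_and (nat_le hbm hk hm) (nat_le hbk hm hk)).congr fun i => by
    congr 1; rw [Nat.le_antisymm_iff]

theorem fin_eq {N : ι → ℕ} {k m : ∀ i, Fin (N i)} (hN : PolyBdd sz N)
    (hk : PolyTime e sz Γ fun i => encNat (k i)) (hm : PolyTime e sz Γ fun i => encNat (m i)) :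
    PolyTime e sz Γ fun i => encProp (k i = m i) :=
  (nat_eq (hN.imp fun P h i => (k i).2.le.trans (h i)) (hN.imp fun P h i => (m i).2.le.trans (h i))
    hk hm).congr fun i => by congr 1; rw [Fin.ext_iff]

/-- A loop through the entries of a list; `st i j` is the state after the first `j` of them. -/
theorem list_loop (l : ι → List Val) (st : ι → ℕ → Val) {e₁ e₂ : ι → ℕ}
    (hlen : ∃ Q : Polynomial ℕ, ∀ i, (l i).length ≤ 3 ^ e₁ i * Q.eval (sz i))
    (he : ∀ i, e₁ i + e₂ i ≤ e i)
    (hl : PolyTime e sz Γ fun i => encList (l i)) (h0 : PolyTime e sz Γ fun i => st i 0)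
    (hstep : PolyTime (ι := Σ i, Fin (l i).length) (fun x => e₂ x.1) (fun x => sz x.1)
      (fun x => .node ((l x.1).get x.2) (.node (st x.1 x.2) (Γ x.1)))
      (fun x => st x.1 (x.2 + 1))) :
    PolyTime e sz Γ fun i => st i (l i).length := by
  have hloop : PolyTime e sz (fun i => .node (encList (l i)) (.node (st i 0) (Γ i)))
      (fun i => .node (encList ((l i).drop (l i).length))
        (.node (st i (l i).length) (Γ i))) := by
    refine while_loop (fun i j => .node (encList ((l i).drop j)) (.node (st i j) (Γ i)))
      (fun i j => encList ((l i).drop j)) hlen he var.left ?_ (by simp [encList]) ?_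
    · intro i j hj h
      rw [List.drop_eq_getElem_cons hj] at h
      simp [encList] at h
    · have hd : ∀ x : Σ i, Fin (l i).length, encList ((l x.1).drop x.2) =
          .node ((l x.1).get x.2) (encList ((l x.1).drop (x.2 + 1))) := by
        rintro ⟨i, j⟩
        simp only
        rw [List.drop_eq_getElem_cons j.2]
        rfl
      refine pair (var.left.right.congr fun x => ?_) (pair (seq (pair
        (var.left.left.congr fun x => ?_) var.right) hstep) var.right.right)
      · simp only [Val.left]; rw [hd]; rfl
      · simp only [Val.left]; rw [hd]
  exact (seq (hl.pair (h0.pair var)) hloop).right.left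

/-- A left fold over a list, which may have exponential length. -/
theorem foldl_list {α σ : ι → Type} (ea : ∀ i, α i → Val) (es : ∀ i, σ i → Val)
    (f : ∀ i, σ i → α i → σ i) {l : ∀ i, List (α i)} {s₀ : ∀ i, σ i} {e₁ e₂ : ι → ℕ}
    (hlen : ∃ Q : Polynomial ℕ, ∀ i, (l i).length ≤ 3 ^ e₁ i * Q.eval (sz i))
    (he : ∀ i, e₁ i + e₂ i ≤ e i)
    (hl : PolyTime e sz Γ fun i => encList ((l i).map (ea i)))
    (h0 : PolyTime e sz Γ fun i => es i (s₀ i))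
    (hstep : PolyTime (ι := Σ i, α i × σ i) (fun x => e₂ x.1) (fun x => sz x.1)
      (fun x => .node (ea x.1 x.2.1) (.node (es x.1 x.2.2) (Γ x.1)))
      (fun x => es x.1 (f x.1 x.2.2 x.2.1))) :
    PolyTime e sz Γ fun i => es i ((l i).foldl (f i) (s₀ i)) := by
  refine (list_loop (Γ := Γ) (fun i => (l i).map (ea i))
    (fun i k => es i (((l i).take k).foldl (f i) (s₀ i)))
    (by simpa using hlen) he hl (h0.congr fun i => by simp) ?_).congr fun i => by simp
  refine (hstep.comp
    (fun x : Σ i, Fin ((l i).map (ea i)).length => ⟨x.1, (l x.1)[x.2]'(by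
      have := x.2.2; simpa using this), ((l x.1).take x.2).foldl (f x.1) (s₀ x.1)⟩)
    (fun _ => le_rfl) (.of_le fun _ => le_rfl) (var.congr ?_)).congr ?_
  · rintro ⟨i, j⟩
    simp
  · rintro ⟨i, j, hj⟩
    have hj' : j < (l i).length := by simpa using hj
    simp only [List.take_succ_eq_append_getElem hj', List.foldl_append]
    rfl

theorem length {l : ι → List Val} (hlen : PolyBdd sz fun i => (l i).length)
    (hl : PolyTime e sz Γ fun i => encList (l i)) :
    PolyTime e sz Γ fun i => encNat (l i).length := by
  obtain ⟨Q, hQ⟩ := hlen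
  exact list_loop l (fun _ j => encNat j) (e₁ := fun _ => 0) ⟨Q, by simpa using hQ⟩
    (fun i => (Nat.zero_add _).le) hl nil (nil.pair var.right.left)

end PolyTime

/-! ### Labellings and cutsets -/

section Labelling

variable {V : Type*} {G : SimpleGraph V}

/-- A labelling with the labels `0` and `2` for the two sides and `1` for the cutset.  The pairs of
labels that may not appear at the ends of an edge, `{0, 2}` and `{1, 1}`, are those with
sum `2`. -/
def IsLabelling (G : SimpleGraph V) (τ : V → Fin 3) : Prop :=
  ∀ u v, G.Adj u v → (τ u : ℕ) + τ v ≠ 2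

theorem IsLabelling.isIndepCutset {τ : V → Fin 3} (h : IsLabelling G τ) {a b : V}
    (ha : τ a = 0) (hb : τ b = 2) : IsIndepCutset G {v | τ v = 1} := by
  constructor
  · intro u hu v hv _ hadj
    exact h u v hadj (by rw [show τ u = 1 from hu, show τ v = 1 from hv]; rfl)
  · intro hconn
    have key : ∀ u v : ({v | τ v = 1}ᶜ : Set V), (G.induce {v | τ v = 1}ᶜ).Reachable u v →
        τ u = 0 → τ v = 0 := by
      rintro u v ⟨w⟩
      induction w with
      | nil => exact id
      | @cons u v w hadj _ ih =>
        intro hu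
        refine ih ?_
        have h1 := h u v hadj
        have h2 : τ v ≠ 1 := v.2
        rw [hu] at h1
        revert h1 h2
        generalize τ v = x
        fin_cases x <;> simp
    have := key ⟨a, by simp [ha]⟩ ⟨b, by simp [hb]⟩ (hconn _ _) ha
    simp [hb] at this

theorem IsIndepCutset.exists_labelling {S : Set V} (h : IsIndepCutset G S) :
    ∃ (τ : V → Fin 3) (a b : V), IsLabelling G τ ∧ τ a = 0 ∧ τ b = 2 := by
  classical
  obtain ⟨hi, hc⟩ := h
  simp only [IsCutset, SimpleGraph.Preconnected, not_forall] at hc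
  obtain ⟨a, b, hab⟩ := hc
  let R : V → Prop := fun v => ∃ h : v ∈ Sᶜ, (G.induce Sᶜ).Reachable a ⟨v, h⟩
  let τ : V → Fin 3 := fun v => if v ∈ S then 1 else if R v then 0 else 2
  have hR : ∀ u v, G.Adj u v → v ∉ S → R u → R v := by
    rintro u v hadj hv ⟨hu, hr⟩
    exact ⟨hv, hr.trans (SimpleGraph.Adj.reachable (by simpa using hadj))⟩
  refine ⟨τ, a, b, ?_, ?_, ?_⟩
  · intro u v hadj
    simp only [τ]
    have h1 := hR u v hadj
    have h2 := hR v u hadj.symm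
    by_cases hu : u ∈ S <;> by_cases hv : v ∈ S
    · exact absurd hadj (hi hu hv hadj.ne)
    · by_cases hRv : R v <;> simp [hu, hv, hRv]
    · by_cases hRu : R u <;> simp [hu, hv, hRu]
    · by_cases hRu : R u <;> by_cases hRv : R v <;> simp_all
  · have : R a := ⟨a.2, .refl _⟩
    simp [τ, this, show (a : V) ∉ S from a.2]
  · have : ¬ R b := fun ⟨_, hr⟩ => hab hr
    simp [τ, this, show (b : V) ∉ S from b.2]

/-! ### Domains and constraint propagation -/

/-- Every vertex has an admissible label.  A family `d` of *domains* consists of a set `d v` of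
admissible labels for each vertex `v`. -/
def AllNonempty (d : V → Fin 3 → Prop) : Prop := ∀ v, ∃ x, d v x

/-- The labelling respects the domains. -/
def Respects (τ : V → Fin 3) (d : V → Fin 3 → Prop) : Prop := ∀ v, d v (τ v)

/-- At most one label is admissible for `v`. -/
def Fixed (d : V → Fin 3 → Prop) (v : V) : Prop := ∃ x, ∀ y, d v y → y = x

/-- One round of constraint propagation: keep the labels that are compatible with some admissible
label at every neighbour. -/
def prune (G : SimpleGraph V) (d : V → Fin 3 → Prop) : V → Fin 3 → Prop :=
  fun v x => d v x ∧ ∀ u, G.Adj v u → ∃ y, d u y ∧ (x : ℕ) + y ≠ 2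

/-- Make `x` the only admissible label of `v`, if it was admissible. -/
def restrict (d : V → Fin 3 → Prop) (v : V) (x : Fin 3) : V → Fin 3 → Prop :=
  fun u y => d u y ∧ (u = v → y = x)

theorem prune_le (d : V → Fin 3 → Prop) : prune G d ≤ d := fun _ _ h => h.1

theorem restrict_le (d : V → Fin 3 → Prop) (v : V) (x : Fin 3) : restrict d v x ≤ d :=
  fun _ _ h => h.1

theorem Respects.allNonempty {τ : V → Fin 3} {d : V → Fin 3 → Prop} (h : Respects τ d) :
    AllNonempty d := fun v => ⟨_, h v⟩

theorem Fixed.mono {d d' : V → Fin 3 → Prop} {v : V} (h : Fixed d' v) (hd : d ≤ d') : Fixed d v :=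
  h.imp fun _ hx y hy => hx y (hd v y hy)

theorem Respects.prune {τ : V → Fin 3} {d : V → Fin 3 → Prop} (h : Respects τ d)
    (hτ : IsLabelling G τ) : Respects τ (prune G d) :=
  fun v => ⟨h v, fun u hu => ⟨τ u, h u, hτ v u hu⟩⟩

theorem Respects.restrict {τ : V → Fin 3} {d : V → Fin 3 → Prop} (h : Respects τ d) (v : V) :
    Respects τ (restrict d v (τ v)) := fun u => ⟨h u, fun huv => by rw [huv]⟩

/-- The label of a vertex whose domain is a singleton. -/
noncomputable def label (d : V → Fin 3 → Prop) (v : V) : Fin 3 :=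
  open Classical in if d v 0 then 0 else if d v 1 then 1 else 2

theorem AllNonempty.label_mem {d : V → Fin 3 → Prop} (h : AllNonempty d) : Respects (label d) d := by
  intro v
  obtain ⟨x, hx⟩ := h v
  unfold label
  split_ifs with h0 h1
  · exact h0
  · exact h1
  · fin_cases x
    · exact absurd hx h0
    · exact absurd hx h1
    · exact hx

theorem Fixed.eq {d : V → Fin 3 → Prop} {v : V} (h : Fixed d v) {x y : Fin 3} (hx : d v x)
    (hy : d v y) : x = y := by
  obtain ⟨z, hz⟩ := h
  rw [hz x hx, hz y hy]

theorem prune_eq_iff {d : V → Fin 3 → Prop} : prune G d = d ↔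
    ∀ u v x, G.Adj u v → d u x → ∃ y, d v y ∧ (x : ℕ) + y ≠ 2 := by
  constructor
  · intro h u v x hadj hx
    rw [← h] at hx
    exact hx.2 v hadj
  · intro h
    exact le_antisymm (prune_le d) fun u x hx => ⟨hx, fun v hv => h u v x hv hx⟩

/-- If `d` is stable under propagation and `τ` satisfies the constraints between vertices that are
not fixed by `d`, then fixing the other labels as in `d` yields a labelling. -/
theorem exists_labelling_of_fixed {d : V → Fin 3 → Prop} (hd : prune G d = d) (hne : AllNonempty d)
    {τ : V → Fin 3} (hτ : ∀ u v, ¬ Fixed d u → ¬ Fixed d v → G.Adj u v → (τ u : ℕ) + τ v ≠ 2)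
    (hτd : ∀ v, ¬ Fixed d v → d v (τ v)) : ∃ τ', IsLabelling G τ' ∧ Respects τ' d := by
  classical
  rw [prune_eq_iff] at hd
  let τ' : V → Fin 3 := fun v => if Fixed d v then label d v else τ v
  have hr : Respects τ' d := by
    intro v
    simp only [τ']
    split_ifs with h
    · exact hne.label_mem v
    · exact hτd v h
  refine ⟨τ', fun u v hadj => ?_, hr⟩
  by_cases hv : Fixed d v
  · obtain ⟨y, hy, hxy⟩ := hd u v _ hadj (hr u)
    rwa [hv.eq (hr v) hy]
  by_cases hu : Fixed d u
  · obtain ⟨y, hy, hxy⟩ := hd v u _ hadj.symm (hr v)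
    rwa [hu.eq (hr u) hy, add_comm]
  · simpa [τ', hu, hv] using hτ u v hu hv hadj

/-- If the vertices of a dominating set are fixed, every domain misses a label: that of a vertex
adjacent to one with label `x` does not contain `2 - x`. -/
theorem exists_not_of_dominating {d : V → Fin 3 → Prop} (hd : prune G d = d) (hne : AllNonempty d)
    {W : Set V} (hW : IsDominatingSet G W) (hfix : ∀ w ∈ W, Fixed d w) (v : V) : ∃ z, ¬ d v z := by
  rcases hW v with hv | ⟨w, hw, hadj⟩
  · by_contra! h
    have := (hfix v hv).eq (h 0) (h 1)
    simp at this
  · obtain ⟨x, hx⟩ := hne w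
    refine ⟨x.rev, fun hz => ?_⟩
    obtain ⟨y, hy, hxy⟩ := prune_eq_iff.1 hd v w _ hadj hz
    rw [(hfix w hw).eq hy hx, Fin.val_rev] at hxy
    omega

theorem exists_dominating_indepSet (G : SimpleGraph V) (A : Finset V) :
    ∃ J ⊆ A, G.IsIndepSet (J : Set V) ∧ ∀ v ∈ A, v ∈ J ∨ ∃ j ∈ J, G.Adj v j := by
  classical
  obtain ⟨J, hJ, hmax⟩ := Finset.exists_max_image
    (A.powerset.filter fun J : Finset V => G.IsIndepSet (J : Set V)) Finset.card
    ⟨∅, by simp [SimpleGraph.IsIndepSet]⟩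
  simp only [Finset.mem_filter, Finset.mem_powerset] at hJ hmax
  refine ⟨J, hJ.1, hJ.2, fun v hv => ?_⟩
  by_contra! h
  have := hmax (insert v J) ⟨Finset.insert_subset hv hJ.1, ?_⟩
  · rw [Finset.card_insert_of_notMem h.1] at this
    omega
  · rw [Finset.coe_insert]
    refine Set.Pairwise.insert hJ.2 fun j hj _ => ⟨h.2 j hj, fun h' => h.2 j hj h'.symm⟩

variable [Fintype V]

/-- Constraint propagation until nothing changes: each effective round removes one of the `3 |V|`
pairs of a vertex and an admissible label. -/
def propagate (G : SimpleGraph V) (d : V → Fin 3 → Prop) : V → Fin 3 → Prop :=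
  (prune G)^[3 * Fintype.card V] d

/-- Give `v` the label `x` and propagate. -/
def assign (G : SimpleGraph V) (d : V → Fin 3 → Prop) (v : V) (x : Fin 3) : V → Fin 3 → Prop :=
  propagate G (restrict d v x)

theorem iterate_le_of_le {α : Type*} [Preorder α] {f : α → α} (hf : ∀ a, f a ≤ a) (m : ℕ) (a : α) :
    f^[m] a ≤ a := by
  induction m with
  | zero => exact le_rfl
  | succ m ih =>
    rw [Function.iterate_succ_apply']
    exact (hf _).trans ih

/-- A decreasing map reaches a fixed point within `m` steps from an element of measure at most `m`. -/
theorem apply_iterate_eq_of_measure {α : Type*} [PartialOrder α] {f : α → α} (hf : ∀ a, f a ≤ a)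
    {μ : α → ℕ} (hμ : StrictMono μ) (m : ℕ) : ∀ a, μ a ≤ m → f (f^[m] a) = f^[m] a := by
  induction m with
  | zero =>
    intro a ha
    by_contra h
    have := hμ (lt_of_le_of_ne (hf a) h)
    omega
  | succ m ih =>
    intro a ha
    by_cases h : f a = a
    · rw [Function.iterate_fixed h, h]
    · have := hμ (lt_of_le_of_ne (hf a) h)
      rw [Function.iterate_succ_apply]
      exact ih (f a) (by omega)

theorem propagate_le (d : V → Fin 3 → Prop) : propagate G d ≤ d := iterate_le_of_le prune_le _ d

theorem prune_propagate (d : V → Fin 3 → Prop) : prune G (propagate G d) = propagate G d := by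
  have hμ : StrictMono fun d : V → Fin 3 → Prop => {p : V × Fin 3 | d p.1 p.2}.ncard := by
    intro d d' h
    refine Set.ncard_lt_ncard ⟨fun p hp => h.le _ _ hp, fun hle => h.not_ge fun v x hx => ?_⟩
    exact hle (a := (v, x)) hx
  refine apply_iterate_eq_of_measure prune_le hμ _ _ ?_
  refine (Set.ncard_le_ncard (Set.subset_univ _)).trans ?_
  simp [Set.ncard_univ, mul_comm]

theorem Respects.propagate {τ : V → Fin 3} {d : V → Fin 3 → Prop} (h : Respects τ d)
    (hτ : IsLabelling G τ) : Respects τ (propagate G d) := by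
  unfold ICut.propagate
  generalize 3 * Fintype.card V = m
  induction m with
  | zero => exact h
  | succ m ih =>
    rw [Function.iterate_succ_apply']
    exact ih.prune hτ

theorem assign_le (d : V → Fin 3 → Prop) (v : V) (x : Fin 3) : assign G d v x ≤ d :=
  (propagate_le _).trans (restrict_le d v x)

theorem prune_assign (d : V → Fin 3 → Prop) (v : V) (x : Fin 3) :
    prune G (assign G d v x) = assign G d v x := prune_propagate _

theorem eq_of_assign {d : V → Fin 3 → Prop} {v : V} {x y : Fin 3} (h : assign G d v x v y) :
    y = x := (propagate_le _ _ _ h).2 rfl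

theorem fixed_assign (d : V → Fin 3 → Prop) (v : V) (x : Fin 3) : Fixed (assign G d v x) v :=
  ⟨x, fun _ h => eq_of_assign h⟩

theorem Respects.assign {τ : V → Fin 3} {d : V → Fin 3 → Prop} (h : Respects τ d)
    (hτ : IsLabelling G τ) (v : V) : Respects τ (assign G d v (τ v)) :=
  (h.restrict v).propagate hτ

/-! ### Completing a labelling when all domains have at most two elements -/

/-- Choose a label for `v` that survives propagation, if there is one. -/
noncomputable def greedyStep (G : SimpleGraph V) (v : V) (d : V → Fin 3 → Prop) :
    V → Fin 3 → Prop :=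
  open Classical in
  if AllNonempty (assign G d v 0) then assign G d v 0
  else if AllNonempty (assign G d v 1) then assign G d v 1
  else assign G d v 2

theorem exists_greedyStep_eq (G : SimpleGraph V) (v : V) (d : V → Fin 3 → Prop) :
    ∃ x, greedyStep G v d = assign G d v x := by
  unfold greedyStep
  split_ifs
  exacts [⟨_, rfl⟩, ⟨_, rfl⟩, ⟨_, rfl⟩]

theorem allNonempty_greedyStep {v : V} {d : V → Fin 3 → Prop} {x : Fin 3}
    (h : AllNonempty (assign G d v x)) : AllNonempty (greedyStep G v d) := by
  unfold greedyStep
  split_ifs with h0 h1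
  · exact h0
  · exact h1
  · fin_cases x
    · exact absurd h h0
    · exact absurd h h1
    · exact h

/-- Limited backtracking: with at most two admissible labels at each vertex, a choice that survives
propagation cannot turn a solvable instance into an unsolvable one, since the vertices not fixed
by the propagation have kept their whole domains. -/
theorem exists_labelling_assign {d : V → Fin 3 → Prop} (hsmall : ∀ v, ∃ z, ¬ d v z) {τ : V → Fin 3}
    (hτ : IsLabelling G τ) (hτd : Respects τ d) {v : V} {x : Fin 3}
    (hne : AllNonempty (assign G d v x)) :
    ∃ τ', IsLabelling G τ' ∧ Respects τ' (assign G d v x) := by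
  refine exists_labelling_of_fixed (prune_assign d v x) hne (τ := τ)
    (fun u w _ _ hadj => hτ u w hadj) fun u hu => ?_
  obtain ⟨y, hy⟩ := hne u
  obtain ⟨y', hy', hyy'⟩ : ∃ y', assign G d v x u y' ∧ y' ≠ y := by
    by_contra! h
    exact hu ⟨y, h⟩
  obtain ⟨z, hz⟩ := hsmall u
  have h1 : y ≠ z := fun h => hz (h ▸ assign_le _ _ _ _ _ hy)
  have h2 : y' ≠ z := fun h => hz (h ▸ assign_le _ _ _ _ _ hy')
  have h3 : τ u ≠ z := fun h => hz (h ▸ hτd u)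
  have h4 : τ u = y ∨ τ u = y' := by omega
  rcases h4 with h4 | h4 <;> rwa [h4]

theorem foldr_greedyStep_le (l : List V) (d : V → Fin 3 → Prop) :
    l.foldr (greedyStep G) d ≤ d := by
  induction l with
  | nil => exact le_rfl
  | cons v l ih =>
    obtain ⟨x, hx⟩ := exists_greedyStep_eq G v (l.foldr (greedyStep G) d)
    rw [List.foldr_cons, hx]
    exact (assign_le _ _ _).trans ih

theorem fixed_foldr_greedyStep {l : List V} (d : V → Fin 3 → Prop) {v : V} (hv : v ∈ l) :
    Fixed (l.foldr (greedyStep G) d) v := by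
  induction l with
  | nil => simp at hv
  | cons w l ih =>
    obtain ⟨x, hx⟩ := exists_greedyStep_eq G w (l.foldr (greedyStep G) d)
    rw [List.foldr_cons, hx]
    rcases List.mem_cons.1 hv with rfl | hv
    · exact fixed_assign _ _ _
    · exact (ih hv).mono (assign_le _ _ _)

theorem prune_foldr_greedyStep {l : List V} (hl : l ≠ []) (d : V → Fin 3 → Prop) :
    prune G (l.foldr (greedyStep G) d) = l.foldr (greedyStep G) d := by
  cases l with
  | nil => exact absurd rfl hl
  | cons w l =>
    obtain ⟨x, hx⟩ := exists_greedyStep_eq G w (l.foldr (greedyStep G) d)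
    rw [List.foldr_cons, hx, prune_assign]

theorem exists_labelling_foldr_greedyStep {d : V → Fin 3 → Prop} (hsmall : ∀ v, ∃ z, ¬ d v z)
    (h : ∃ τ, IsLabelling G τ ∧ Respects τ d) (l : List V) :
    ∃ τ, IsLabelling G τ ∧ Respects τ (l.foldr (greedyStep G) d) := by
  induction l with
  | nil => exact h
  | cons v l ih =>
    obtain ⟨τ, hτ, hτd⟩ := ih
    obtain ⟨x, hx⟩ := exists_greedyStep_eq G v (l.foldr (greedyStep G) d)
    have := allNonempty_greedyStep (hτd.assign hτ v).allNonempty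
    rw [List.foldr_cons]
    rw [hx] at this ⊢
    exact exists_labelling_assign
      (fun u => (hsmall u).imp fun z hz hz' => hz (foldr_greedyStep_le _ _ _ _ hz')) hτ hτd this

/-! ### Branching on a set of vertices -/

/-- The ways to fix the label of `v` that survive propagation. -/
noncomputable def branchStep (G : SimpleGraph V) (v : V) (d : V → Fin 3 → Prop) :
    List (V → Fin 3 → Prop) :=
  open Classical in ((List.finRange 3).map (assign G d v)).filter fun d' => AllNonempty d'

/-- The ways to fix the labels of the members of `W` in the list `l` that survive propagation.  The
list is reversed at each step because it is processed by a loop that adds the new entries in front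
of an accumulator. -/
noncomputable def branches (G : SimpleGraph V) (W : Set V) (l : List V) :
    List (V → Fin 3 → Prop) :=
  open Classical in
  l.foldr (fun v L => if v ∈ W then L.reverse.flatMap (branchStep G v) else L) [fun _ _ => True]

theorem mem_branchStep {v : V} {d d' : V → Fin 3 → Prop} :
    d' ∈ branchStep G v d ↔ ∃ x, assign G d v x = d' ∧ AllNonempty d' := by
  simp [branchStep]

theorem exists_mem_branches {τ : V → Fin 3} (hτ : IsLabelling G τ) (W : Set V) (l : List V) :
    ∃ d ∈ branches G W l, Respects τ d := by
  induction l with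
  | nil => exact ⟨_, List.mem_singleton_self _, fun _ => trivial⟩
  | cons v l ih =>
    obtain ⟨d, hd, hτd⟩ := ih
    by_cases hv : v ∈ W
    · refine ⟨assign G d v (τ v), ?_, hτd.assign hτ v⟩
      simp only [branches, List.foldr_cons, hv, if_true, List.mem_flatMap, List.mem_reverse]
      exact ⟨d, hd, mem_branchStep.2 ⟨_, rfl, (hτd.assign hτ v).allNonempty⟩⟩
    · exact ⟨d, by simpa only [branches, List.foldr_cons, hv, if_false] using hd, hτd⟩

theorem branches_spec {W : Set V} {l : List V} {d : V → Fin 3 → Prop} (hd : d ∈ branches G W l) :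
    prune G d = d ∧ AllNonempty d ∧ ∀ v ∈ W, v ∈ l → Fixed d v := by
  induction l generalizing d with
  | nil =>
    obtain rfl := List.mem_singleton.1 hd
    refine ⟨prune_eq_iff.2 fun u v x _ _ => ?_, fun _ => ⟨0, trivial⟩, by simp⟩
    fin_cases x
    · exact ⟨0, trivial, by simp⟩
    · exact ⟨0, trivial, by simp⟩
    · exact ⟨2, trivial, by simp⟩
  | cons v l ih =>
    by_cases hv : v ∈ W
    · simp only [branches, List.foldr_cons, hv, if_true, List.mem_flatMap, List.mem_reverse,
        mem_branchStep] at hd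
      obtain ⟨d₀, hd₀, x, rfl, hne⟩ := hd
      refine ⟨prune_assign _ _ _, hne, fun w hw hwl => ?_⟩
      rcases List.mem_cons.1 hwl with rfl | hwl
      · exact fixed_assign _ _ _
      · exact ((ih hd₀).2.2 w hw hwl).mono (assign_le _ _ _)
    · simp only [branches, List.foldr_cons, hv, if_false] at hd
      refine ⟨(ih hd).1, (ih hd).2.1, fun w hw hwl => ?_⟩
      rcases List.mem_cons.1 hwl with rfl | hwl
      · exact absurd hw hv
      · exact (ih hd).2.2 w hw hwl

/-! ### The number of branches -/

/-- The labels of the fixed vertices, extended by `0`. -/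
noncomputable def branchKey (W : Set V) (l : List V) (d : V → Fin 3 → Prop) : V → Fin 3 :=
  open Classical in fun v => if v ∈ W ∧ v ∈ l then label d v else 0

/-- Different branches differ in the label of a fixed vertex: two branches obtained from the same
branch differ at `v`, and two obtained from different ones differ where those did, because
propagation never changes the label of a fixed vertex. -/
theorem nodup_map_branchKey (W : Set V) (l : List V) :
    ((branches G W l).map (branchKey W l)).Nodup := by
  induction l with
  | nil => exact List.nodup_singleton _
  | cons v l ih =>
    by_cases hv : v ∈ W
    · simp only [branches, List.foldr_cons, hv, if_true]
      rw [← branches, List.map_flatMap, List.nodup_flatMap]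
      constructor
      · intro d hd
        rw [branchStep, List.filter_map, List.map_map]
        refine List.Nodup.map_on (fun x hx y hy hxy => ?_) ((List.nodup_finRange 3).filter _)
        have hx : AllNonempty (assign G d v x) := by simpa using hx
        have hy : AllNonempty (assign G d v y) := by simpa using hy
        have := congrFun hxy v
        simp only [Function.comp_apply, branchKey, hv, List.mem_cons_self, and_self, if_true] at this
        rw [← eq_of_assign (hx.label_mem v), ← eq_of_assign (hy.label_mem v), this]
      · rw [← List.nodup_reverse, ← List.map_reverse, List.Nodup, List.pairwise_map] at ih
        refine ih.imp_of_mem fun {d d'} hd hd' hne => ?_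
        rw [Function.onFun, List.disjoint_left]
        simp only [List.mem_map, mem_branchStep]
        rintro _ ⟨_, ⟨x, rfl, hx⟩, rfl⟩ ⟨_, ⟨y, rfl, hy⟩, h⟩
        refine hne (funext fun u => ?_)
        have hlab : ∀ (d : V → Fin 3 → Prop) (z : Fin 3), d ∈ (branches G W l).reverse →
            AllNonempty (assign G d v z) → u ∈ W → u ∈ l →
            label (assign G d v z) u = label d u := by
          intro d z hd hz hu hul
          have := branches_spec (List.mem_reverse.1 hd)
          exact (this.2.2 u hu hul).eq (assign_le _ _ _ _ _ (hz.label_mem u)) (this.2.1.label_mem u)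
        have hu := congrFun h u
        simp only [branchKey] at hu ⊢
        split_ifs with hul
        · simpa [hul.1, hul.2, hlab d x hd hx, hlab d' y hd' hy] using hu.symm
        · rfl
    · simp only [branches, List.foldr_cons, hv, if_false]
      rw [← branches, List.map_congr_left (g := branchKey W l)]
      · exact ih
      intro d _
      funext u
      by_cases hu : u = v
      · subst hu; simp [branchKey, hv]
      · classical exact if_congr (by simp [hu]) rfl rfl

theorem card_le_of_indepNum_induce_le {Y : Set V} {c : ℕ} (hY : (G.induce Y).indepNum ≤ c)
    {S : Finset V} (hSY : (S : Set V) ⊆ Y) (hS : G.IsIndepSet (S : Set V)) : S.card ≤ c := by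
  classical
  have hi : (G.induce Y).IsIndepSet ((S.subtype (· ∈ Y) : Finset Y) : Set Y) := by
    intro u hu v hv huv
    simp only [Finset.mem_coe, Finset.mem_subtype] at hu hv
    exact hS hu hv fun h => huv (Subtype.ext h)
  have hc : (S.subtype (· ∈ Y)).card = S.card := by
    rw [Finset.card_subtype, Finset.filter_true_of_mem fun v hv => hSY hv]
  rw [← hc]
  exact hi.card_le_indepNum.trans hY

theorem card_filter_card_le (c : ℕ) :
    (Finset.univ.filter fun s : Finset V => s.card ≤ c).card ≤ (Fintype.card V + 1) ^ c := by
  classical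
  induction c with
  | zero =>
    rw [pow_zero, Finset.card_le_one]
    simp +contextual
  | succ c ih =>
    have : (Finset.univ.filter fun s : Finset V => s.card ≤ c + 1) ⊆
        ((Finset.univ : Finset (Option V)) ×ˢ
          Finset.univ.filter fun s : Finset V => s.card ≤ c).image
          fun p => p.1.elim p.2 fun v => insert v p.2 := by
      intro s hs
      simp only [Finset.mem_filter_univ] at hs
      simp only [Finset.mem_image, Finset.mem_product, Finset.mem_univ, true_and,
        Finset.mem_filter_univ, Prod.exists]
      rcases s.eq_empty_or_nonempty with rfl | ⟨v, hv⟩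
      · exact ⟨none, ∅, by simp⟩
      · refine ⟨some v, s.erase v, ?_, by simp [hv]⟩
        rw [Finset.card_erase_of_mem hv]
        omega
    refine (Finset.card_le_card this).trans (Finset.card_image_le.trans ?_)
    rw [Finset.card_product, Finset.card_univ, Fintype.card_option, pow_succ']
    exact Nat.mul_le_mul_left _ ih

/-- The number of partial labellings of `X ∪ Y`, where `Y` has no independent subset with
more than `c` elements.  Such a labelling is
determined by its restriction to `X`, the set of vertices of `Y` with label `1`, and a maximal
independent subset `J` of the set of those with label `0`: a vertex of `Y` with a label other
than `1` has label `0` if and only if it belongs to `J` or has a neighbour in `J`. -/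
theorem card_partial_labellings_le {X : Finset V} {Y : Set V} {c : ℕ}
    (hY : ∀ S : Finset V, (S : Set V) ⊆ Y → G.IsIndepSet (S : Set V) → S.card ≤ c)
    {P : Set V} (hP : P ⊆ X ∪ Y) (K : Finset (V → Fin 3))
    (hK : ∀ g ∈ K, (∀ v ∉ P, g v = 0) ∧ ∀ u ∈ P, ∀ v ∈ P, G.Adj u v → (g u : ℕ) + g v ≠ 2) :
    K.card ≤ 3 ^ X.card * ((Fintype.card V + 1) ^ c * (Fintype.card V + 1) ^ c) := by
  classical
  choose J hJA hJi hJd using exists_dominating_indepSet G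
  let A : Fin 3 → (V → Fin 3) → Finset V := fun x g =>
    Finset.univ.filter fun v => v ∈ P ∧ v ∈ Y ∧ g v = x
  have hA : ∀ {x g v}, v ∈ A x g ↔ v ∈ P ∧ v ∈ Y ∧ g v = x := by simp [A]
  let 𝒮 := Finset.univ.filter fun s : Finset V => s.card ≤ c
  have hsmall : ∀ {s x g}, s ⊆ A x g → G.IsIndepSet (s : Set V) → s ∈ 𝒮 := by
    intro s x g hs hi
    simp only [𝒮, Finset.mem_filter_univ]
    exact hY s (fun v hv => (hA.1 (hs hv)).2.1) hi
  let φ : (V → Fin 3) → (X → Fin 3) × Finset V × Finset V := fun g =>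
    (fun v => g v, A 1 g, J (A 0 g))
  have hmaps : ∀ g ∈ K, φ g ∈ (Finset.univ : Finset (X → Fin 3)) ×ˢ (𝒮 ×ˢ 𝒮) := by
    intro g hg
    simp only [φ, Finset.mem_product, Finset.mem_univ, true_and]
    refine ⟨hsmall subset_rfl fun u hu v hv _ hadj => ?_, hsmall (hJA _) (hJi _)⟩
    have hu := hA.1 hu
    have hv := hA.1 hv
    exact (hK g hg).2 u hu.1 v hv.1 hadj (by simp [hu.2.2, hv.2.2])
  have hzero : ∀ g ∈ K, ∀ v ∈ P, v ∈ Y → g v ≠ 1 →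
      (g v = 0 ↔ v ∈ J (A 0 g) ∨ ∃ j ∈ J (A 0 g), G.Adj v j) := by
    intro g hg v hv hvY h1
    constructor
    · exact fun h0 => hJd _ v (hA.2 ⟨hv, hvY, h0⟩)
    · rintro (h | ⟨j, hj, hadj⟩)
      · exact (hA.1 (hJA _ h)).2.2
      · have hj := hA.1 (hJA _ hj)
        have := (hK g hg).2 v hv j hj.1 hadj
        rw [hj.2.2] at this
        revert h1 this
        generalize g v = x
        fin_cases x <;> simp
  have hinj : Set.InjOn φ K := by
    intro g hg g' hg' h
    simp only [φ, Prod.mk.injEq] at h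
    obtain ⟨hX, h1, h0⟩ := h
    funext v
    by_cases hv : v ∈ P
    · rcases hP hv with hvX | hvY
      · exact congrFun hX ⟨v, hvX⟩
      · have h1v : g v = 1 ↔ g' v = 1 := by
          have := Finset.ext_iff.1 h1 v
          simpa [hA, hv, hvY] using this
        by_cases hg1 : g v = 1
        · rw [hg1, h1v.1 hg1]
        · have h0v : g v = 0 ↔ g' v = 0 := by
            rw [hzero g hg v hv hvY hg1, hzero g' hg' v hv hvY (h1v.not.1 hg1), h0]
          omega
    · rw [(hK g hg).1 v hv, (hK g' hg').1 v hv]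
  refine (Finset.card_le_card_of_injOn φ hmaps hinj).trans ?_
  rw [Finset.card_product, Finset.card_product]
  have := card_filter_card_le (V := V) c
  gcongr
  simp

theorem length_branches_le {X : Finset V} {Y : Set V} {c : ℕ}
    (hY : ∀ S : Finset V, (S : Set V) ⊆ Y → G.IsIndepSet (S : Set V) → S.card ≤ c) (l : List V) :
    (branches G (X ∪ Y) l).length ≤
      3 ^ X.card * ((Fintype.card V + 1) ^ c * (Fintype.card V + 1) ^ c) := by
  classical
  rw [← List.length_map (branchKey (X ∪ Y) l),
    ← List.toFinset_card_of_nodup (nodup_map_branchKey (X ∪ Y) l)]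
  refine card_partial_labellings_le hY (P := {v | v ∈ (X ∪ Y : Set V) ∧ v ∈ l})
    (fun v hv => hv.1) _ ?_
  intro g hg
  simp only [List.mem_toFinset, List.mem_map] at hg
  obtain ⟨d, hd, rfl⟩ := hg
  obtain ⟨hc, hne, hfix⟩ := branches_spec hd
  refine ⟨fun v hv => if_neg hv, fun u hu v hv hadj => ?_⟩
  rw [show branchKey (X ∪ Y) l d u = label d u from if_pos hu,
    show branchKey (X ∪ Y) l d v = label d v from if_pos hv]
  obtain ⟨y, hy, hxy⟩ := prune_eq_iff.1 hc u v _ hadj (hne.label_mem u)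
  rwa [(hfix v hv.1 hv.2).eq (hne.label_mem v) hy]

end Labelling

/-! ### The search for an independent cutset -/

section Search

variable {V : Type*} [Fintype V] {G : SimpleGraph V}

/-- The cutset that is read off from a family of singleton domains. -/
noncomputable def cutsetOf (d : V → Fin 3 → Prop) : Option (Finset V) :=
  open Classical in if AllNonempty d then some (Finset.univ.filter fun v => d v 1) else none

/-- Try to complete the domains `d` to a labelling with `a` and `b` on different sides. -/
noncomputable def attempt (G : SimpleGraph V) (l : List V) (d : V → Fin 3 → Prop) (a b : V) :
    Option (Finset V) :=
  cutsetOf (l.foldr (greedyStep G) (restrict (restrict d a 0) b 2))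

/-- Try all branches for the labels of the members of `W`, together with all choices of a vertex
`a` on one side and a vertex `b` on the other. -/
noncomputable def search (G : SimpleGraph V) (W : Set V) (l : List V) : Option (Finset V) :=
  (branches G W l).findSome? fun d => l.findSome? fun a => l.findSome? fun b => attempt G l d a b

/-- All domains are singletons after the greedy completion, so stability under propagation makes
the remaining labels a labelling. -/
theorem isIndepCutset_of_attempt {l : List V} (hl : ∀ v, v ∈ l) {d : V → Fin 3 → Prop} {a b : V}
    {S : Finset V} (h : attempt G l d a b = some S) : IsIndepCutset G (S : Set V) := by
  classical
  set r := l.foldr (greedyStep G) (restrict (restrict d a 0) b 2) with hr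
  have hle : r ≤ restrict (restrict d a 0) b 2 := foldr_greedyStep_le _ _
  have hfix : ∀ v, Fixed r v := fun v => fixed_foldr_greedyStep _ (hl v)
  rw [attempt, cutsetOf, ← hr] at h
  split_ifs at h with hne
  obtain ⟨τ, hτ, hτr⟩ := exists_labelling_of_fixed (τ := fun _ => 0)
    (prune_foldr_greedyStep (List.ne_nil_of_mem (hl a)) _) hne (fun u _ hu => absurd (hfix u) hu)
    (fun v hv => absurd (hfix v) hv)
  obtain rfl := Option.some.inj h
  have hS : ((Finset.univ.filter fun v => r v 1 : Finset V) : Set V) = {v | τ v = 1} := by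
    ext v
    simp only [Finset.coe_filter_univ]
    exact ⟨fun hv => (hfix v).eq (hτr v) hv, fun hv => by
      have := hτr v
      rwa [show τ v = 1 from hv] at this⟩
  rw [hS]
  exact hτ.isIndepCutset (a := a) (b := b) ((hle _ _ (hτr a)).1.2 rfl) ((hle _ _ (hτr b)).2 rfl)

theorem attempt_ne_none {l : List V} {d : V → Fin 3 → Prop} (hsmall : ∀ v, ∃ z, ¬ d v z)
    {τ : V → Fin 3} (hτ : IsLabelling G τ) (hτd : Respects τ d) {a b : V} (ha : τ a = 0)
    (hb : τ b = 2) : attempt G l d a b ≠ none := by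
  obtain ⟨τ', -, h'⟩ := exists_labelling_foldr_greedyStep (G := G)
    (d := restrict (restrict d a 0) b 2) (fun v => (hsmall v).imp fun z hz h => hz h.1.1)
    ⟨τ, hτ, ha ▸ hb ▸ (hτd.restrict a).restrict b⟩ l
  simp [attempt, cutsetOf, h'.allNonempty]

theorem isIndepCutset_of_search {W : Set V} {l : List V} (hl : ∀ v, v ∈ l) {S : Finset V}
    (h : search G W l = some S) : IsIndepCutset G (S : Set V) := by
  obtain ⟨d, -, h⟩ := List.exists_of_findSome?_eq_some h
  obtain ⟨a, -, h⟩ := List.exists_of_findSome?_eq_some h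
  obtain ⟨b, -, h⟩ := List.exists_of_findSome?_eq_some h
  exact isIndepCutset_of_attempt hl h

theorem not_isIndepCutset_of_search {W : Set V} (hW : IsDominatingSet G W) {l : List V}
    (hl : ∀ v, v ∈ l) (h : search G W l = none) (S : Set V) : ¬ IsIndepCutset G S := by
  intro hS
  obtain ⟨τ, a, b, hτ, ha, hb⟩ := hS.exists_labelling
  obtain ⟨d, hd, hτd⟩ := exists_mem_branches hτ W l
  obtain ⟨hcl, hne, hfix⟩ := branches_spec hd
  simp only [search, List.findSome?_eq_none_iff] at h
  exact attempt_ne_none (exists_not_of_dominating hcl hne hW fun w hw => hfix w hw (hl w))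
    hτ hτd ha hb (h d hd a (hl a) b (hl b))

end Search

/-! ### Programs for the search -/

/-- A family of domains as a matrix of truth values. -/
noncomputable def encDom {n : ℕ} (d : Fin n → Fin 3 → Prop) : Val :=
  encList (List.ofFn fun v => encList (List.ofFn fun x => encProp (d v x)))

theorem encSet_eq {n : ℕ} (S : Finset (Fin n)) :
    encSet S = encList (List.ofFn fun v => encProp (v ∈ S)) := by
  unfold encSet encProp
  congr!

theorem foldl_branchStep {V : Type*} [Fintype V] (G : SimpleGraph V) (v : V)
    (L : List (V → Fin 3 → Prop)) :
    L.foldl (fun acc d => branchStep G v d ++ acc) [] = L.reverse.flatMap (branchStep G v) := by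
  have : ∀ acc, L.foldl (fun acc d => branchStep G v d ++ acc) acc =
      L.reverse.flatMap (branchStep G v) ++ acc := by
    induction L with
    | nil => simp
    | cons d L ih => intro acc; simp [ih]
  simpa using this []

open Classical in
theorem foldr_branchStep {V : Type*} [Fintype V] (G : SimpleGraph V) (v : V)
    (d : V → Fin 3 → Prop) (acc : List (V → Fin 3 → Prop)) :
    (List.finRange 3).foldr (fun x acc => if AllNonempty (assign G d v x)
      then assign G d v x :: acc else acc) acc = branchStep G v d ++ acc := by
  unfold branchStep
  induction List.finRange 3 with
  | nil => rfl
  | cons x l ih =>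
    rw [List.foldr_cons, ih, List.map_cons, List.filter_cons]
    split_ifs <;> simp_all

theorem foldr_or_eq_findSome? {α β : Type*} (f : α → Option β) (l : List α) :
    l.foldr (fun a o => (f a).or o) none = l.findSome? f := by
  induction l with
  | nil => rfl
  | cons a l ih =>
    rw [List.foldr_cons, ih, List.findSome?_cons]
    cases f a <;> rfl

theorem foldl_or_eq_findSome? {α β : Type*} (f : α → Option β) (l : List α) (o : Option β) :
    l.foldl (fun o a => o.or (f a)) o = o.or (l.findSome? f) := by
  induction l generalizing o with
  | nil => simp
  | cons a l ih =>
    rw [List.foldl_cons, ih, List.findSome?_cons]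
    cases o <;> cases f a <;> simp

namespace PolyTime

variable {ι : Type} {e sz : ι → ℕ} {Γ : ι → Val} {n : ι → ℕ}
  {G : ∀ i, SimpleGraph (Fin (n i))} {d : ∀ i, Fin (n i) → Fin 3 → Prop}

theorem size (hb : PolyBdd sz n) (hG : PolyTime e sz Γ fun i => encGraph (G i)) :
    PolyTime e sz Γ fun i => encNat (n i) :=
  (length (by simpa using hb) hG).congr fun i => by simp

theorem adj (hb : PolyBdd sz n) (hG : PolyTime e sz Γ fun i => encGraph (G i))
    {u v : ∀ i, Fin (n i)} (hu : PolyTime e sz Γ fun i => encNat (u i))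
    (hv : PolyTime e sz Γ fun i => encNat (v i)) :
    PolyTime e sz Γ fun i => encProp ((G i).Adj (u i) (v i)) :=
  get_ofFn (g := fun i j => encProp ((G i).Adj (u i) j)) hb
    (get_ofFn (g := fun i k => encList (List.ofFn fun j => encProp ((G i).Adj k j))) hb hG hu) hv

theorem mem (hb : PolyBdd sz n) {S : ∀ i, Finset (Fin (n i))}
    (hS : PolyTime e sz Γ fun i => encSet (S i)) {v : ∀ i, Fin (n i)}
    (hv : PolyTime e sz Γ fun i => encNat (v i)) :
    PolyTime e sz Γ fun i => encProp (v i ∈ S i) :=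
  get_ofFn (g := fun i j => encProp (j ∈ S i)) hb (hS.congr fun i => (encSet_eq (S i)).symm) hv

theorem admissible (hb : PolyBdd sz n) (hd : PolyTime e sz Γ fun i => encDom (d i))
    {v : ∀ i, Fin (n i)} (hv : PolyTime e sz Γ fun i => encNat (v i)) {x : ι → Fin 3}
    (hx : PolyTime e sz Γ fun i => encNat (x i)) :
    PolyTime e sz Γ fun i => encProp (d i (v i) (x i)) :=
  get_ofFn (N := fun _ => 3) (g := fun i x => encProp (d i (v i) x)) (.const _ 3)
    (get_ofFn (g := fun i v => encList (List.ofFn fun x => encProp (d i v x))) hb hd hv) hx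

theorem dom_mk (hb : PolyBdd sz n) (hn : PolyTime e sz Γ fun i => encNat (n i))
    (h : PolyTime (ι := Σ i, Fin (n i) × Fin 3) (fun x => e x.1) (fun x => sz x.1)
      (fun x => .node (encNat x.2.1) (.node (encNat x.2.2) (Γ x.1)))
      (fun x => encProp (d x.1 x.2.1 x.2.2))) : PolyTime e sz Γ fun i => encDom (d i) := by
  refine ofFn hb hn (ofFn (N := fun _ => 3) (.const _ 3) (nat_const 3) ?_)
  exact h.lift (fun x : Σ _ : (Σ i, Fin (n i)), Fin 3 =>
    (⟨x.1.1, x.1.2, x.2⟩ : Σ i, Fin (n i) × Fin 3)) (var.right.left.pair (var.left.pair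
      var.right.right))

theorem compatible {x y : ι → Fin 3} (hx : PolyTime e sz Γ fun i => encNat (x i))
    (hy : PolyTime e sz Γ fun i => encNat (y i)) :
    PolyTime e sz Γ fun i => encProp ((x i : ℕ) + y i ≠ 2) := by
  have hb : ∀ x : ι → Fin 3, PolyBdd sz fun i => (x i : ℕ) := fun x =>
    (PolyBdd.const sz 3).imp fun _ h i => (x i).2.le.trans (h i)
  have eq : ∀ {x : ι → Fin 3}, PolyTime e sz Γ (fun i => encNat (x i)) → ∀ m : ℕ,
      PolyTime e sz Γ fun i => encProp ((x i : ℕ) = m) := fun {x} hx m =>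
    nat_eq (hb x) (.const _ m) hx (nat_const m)
  refine (prop_not (prop_or (prop_and (eq hx 0) (eq hy 2)) (prop_or (prop_and (eq hx 1) (eq hy 1))
    (prop_and (eq hx 2) (eq hy 0))))).congr fun i => ?_
  congr 1
  have := (x i).2
  have := (y i).2
  exact propext (by omega)

theorem dom_prune (hb : PolyBdd sz n) (hG : PolyTime e sz Γ fun i => encGraph (G i))
    (hd : PolyTime e sz Γ fun i => encDom (d i)) :
    PolyTime e sz Γ fun i => encDom (prune (G i) (d i)) := by
  have hb' : ∀ {κ : Type} (π : κ → ι), PolyBdd (fun x => sz (π x)) (fun x => n (π x)) :=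
    fun π => hb.imp fun _ h x => h (π x)
  refine dom_mk hb (size hb hG) (prop_and ?_ (prop_forall (hb' _)
    ((size hb hG).lift (fun x : Σ i, Fin (n i) × Fin 3 => x.1) var.right.right)
    (prop_imp ?_ (prop_exists (N := fun _ => 3) (.const _ 3) (nat_const 3) (prop_and ?_ ?_)))))
  · exact admissible (hb' _) (hd.lift _ var.right.right) var.left var.right.left
  · exact adj (hb' _)
      (hG.lift (fun x : Σ y : (Σ i, Fin (n i) × Fin 3), Fin (n y.1) => x.1.1)
        var.right.right.right) var.right.left var.left
  · exact admissible (hb' _) (hd.lift (fun x : Σ _ : (Σ y : (Σ i, Fin (n i) × Fin 3), Fin (n y.1)),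
      Fin 3 => x.1.1.1) var.right.right.right.right) var.right.left var.left
  · exact compatible (x := fun x : Σ _ : (Σ y : (Σ i, Fin (n i) × Fin 3), Fin (n y.1)),
      Fin 3 => x.1.1.2.2) var.right.right.right.left var.left

theorem dom_restrict (hb : PolyBdd sz n) (hn : PolyTime e sz Γ fun i => encNat (n i))
    (hd : PolyTime e sz Γ fun i => encDom (d i)) {v : ∀ i, Fin (n i)}
    (hv : PolyTime e sz Γ fun i => encNat (v i)) {x : ι → Fin 3}
    (hx : PolyTime e sz Γ fun i => encNat (x i)) :
    PolyTime e sz Γ fun i => encDom (restrict (d i) (v i) (x i)) := by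
  have hb' : ∀ {κ : Type} (π : κ → ι), PolyBdd (fun x => sz (π x)) (fun x => n (π x)) :=
    fun π => hb.imp fun _ h x => h (π x)
  refine dom_mk hb hn (prop_and ?_ (prop_imp ?_ ?_))
  · exact admissible (hb' _) (hd.lift _ var.right.right) var.left var.right.left
  · exact fin_eq (hb' _) var.left
      (hv.lift (fun x : Σ i, Fin (n i) × Fin 3 => x.1) var.right.right)
  · exact fin_eq (N := fun _ => 3) (.const _ 3) var.right.left
      (hx.lift (fun x : Σ i, Fin (n i) × Fin 3 => x.1) var.right.right)

theorem dom_propagate (hb : PolyBdd sz n) (hG : PolyTime e sz Γ fun i => encGraph (G i))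
    (hd : PolyTime e sz Γ fun i => encDom (d i)) :
    PolyTime e sz Γ fun i => encDom (propagate (G i) (d i)) := by
  refine (foldr_fin (σ := fun i => Fin (n i) → Fin 3 → Prop) (fun _ => encDom)
    (fun i _ => (prune (G i))^[3]) hb (size hb hG) hd ?_).congr fun i => ?_
  · have hb' : PolyBdd (fun x : Σ i, Fin (n i) × (Fin (n i) → Fin 3 → Prop) => sz x.1)
        fun x => n x.1 := hb.imp fun _ h x => h x.1
    have hG' := hG.lift (Δ := fun x : Σ i, Fin (n i) × (Fin (n i) → Fin 3 → Prop) =>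
      .node (encNat x.2.1) (.node (encDom x.2.2) (Γ x.1))) (fun x => x.1) var.right.right
    exact dom_prune hb' hG' (dom_prune hb' hG' (dom_prune hb' hG' var.right.left))
  · rw [List.foldr_const, List.length_finRange, ← Function.iterate_mul, propagate, Fintype.card_fin]

theorem dom_assign (hb : PolyBdd sz n) (hG : PolyTime e sz Γ fun i => encGraph (G i))
    (hd : PolyTime e sz Γ fun i => encDom (d i)) {v : ∀ i, Fin (n i)}
    (hv : PolyTime e sz Γ fun i => encNat (v i)) {x : ι → Fin 3}
    (hx : PolyTime e sz Γ fun i => encNat (x i)) :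
    PolyTime e sz Γ fun i => encDom (assign (G i) (d i) (v i) (x i)) :=
  dom_propagate hb hG (dom_restrict hb (size hb hG) hd hv hx)

theorem dom_allNonempty (hb : PolyBdd sz n) (hn : PolyTime e sz Γ fun i => encNat (n i))
    (hd : PolyTime e sz Γ fun i => encDom (d i)) :
    PolyTime e sz Γ fun i => encProp (AllNonempty (d i)) := by
  refine prop_forall hb hn (prop_exists (N := fun _ => 3) (.const _ 3) (nat_const 3) ?_)
  exact admissible (hb.imp fun _ h x => h x.1.1)
    (hd.lift (fun x : Σ _ : (Σ i, Fin (n i)), Fin 3 => x.1.1) var.right.right) var.right.left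
    var.left

theorem dom_greedyStep (hb : PolyBdd sz n) (hG : PolyTime e sz Γ fun i => encGraph (G i))
    (hd : PolyTime e sz Γ fun i => encDom (d i)) {v : ∀ i, Fin (n i)}
    (hv : PolyTime e sz Γ fun i => encNat (v i)) :
    PolyTime e sz Γ fun i => encDom (greedyStep (G i) (v i) (d i)) := by
  classical
  have h : ∀ x : Fin 3, PolyTime e sz Γ fun i => encDom (assign (G i) (d i) (v i) x) := fun x =>
    dom_assign hb hG hd hv (nat_const x)
  refine (ite (dom_allNonempty hb (size hb hG) (h 0)) (h 0)
    (ite (dom_allNonempty hb (size hb hG) (h 1)) (h 1) (h 2))).congr fun i => ?_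
  unfold greedyStep
  split_ifs <;> rfl

theorem answer_or {o o' : ∀ i, Option (Finset (Fin (n i)))}
    (ho : PolyTime e sz Γ fun i => encAnswer (o i))
    (ho' : PolyTime e sz Γ fun i => encAnswer (o' i)) :
    PolyTime e sz Γ fun i => encAnswer ((o i).or (o' i)) := by
  refine ite_nil ho ho ho' (fun i h => ?_) fun i h => ?_
  · cases ho : o i with
    | none => simp [ho, encAnswer] at h
    | some S => rfl
  · cases ho : o i with
    | none => rfl
    | some S => simp [ho, encAnswer] at h

theorem findSome_fin {N : ι → ℕ} {f : ∀ i, Fin (N i) → Option (Finset (Fin (n i)))}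
    (hN : PolyBdd sz N) (hn : PolyTime e sz Γ fun i => encNat (N i))
    (hstep : PolyTime (ι := Σ i, Fin (N i)) (fun x => e x.1) (fun x => sz x.1)
      (fun x => .node (encNat x.2) (Γ x.1)) (fun x => encAnswer (f x.1 x.2))) :
    PolyTime e sz Γ fun i => encAnswer ((List.finRange (N i)).findSome? (f i)) := by
  refine (foldr_fin (σ := fun i => Option (Finset (Fin (n i)))) (fun _ => encAnswer)
    (fun i a o => (f i a).or o) (s₀ := fun _ => none) hN hn nil ?_).congr fun i => by
      rw [foldr_or_eq_findSome?]
  exact answer_or (hstep.lift (fun x : Σ i, Fin (N i) × Option (Finset (Fin (n i))) =>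
    (⟨x.1, x.2.1⟩ : Σ i, Fin (N i))) (var.left.pair var.right.right)) var.right.left

theorem findSome_list {L : ∀ i, List (Fin (n i) → Fin 3 → Prop)}
    {f : ∀ i, (Fin (n i) → Fin 3 → Prop) → Option (Finset (Fin (n i)))}
    (hlen : ∃ Q : Polynomial ℕ, ∀ i, (L i).length ≤ 3 ^ e i * Q.eval (sz i))
    (hL : PolyTime e sz Γ fun i => encList ((L i).map encDom))
    (hstep : PolyTime (ι := Σ i, Fin (n i) → Fin 3 → Prop) (fun _ => 0) (fun x => sz x.1)
      (fun x => .node (encDom x.2) (Γ x.1)) (fun x => encAnswer (f x.1 x.2))) :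
    PolyTime e sz Γ fun i => encAnswer ((L i).findSome? (f i)) := by
  refine (foldl_list (α := fun i => Fin (n i) → Fin 3 → Prop)
    (σ := fun i => Option (Finset (Fin (n i)))) (fun _ => encDom) (fun _ => encAnswer)
    (fun i o d => o.or (f i d)) (s₀ := fun _ => none) (e₂ := fun _ => 0) hlen (fun _ => le_rfl) hL
    nil ?_).congr fun i => by rw [foldl_or_eq_findSome?, Option.none_or]
  exact answer_or var.right.left (hstep.lift
    (fun x : Σ i, (Fin (n i) → Fin 3 → Prop) × Option (Finset (Fin (n i))) =>
      (⟨x.1, x.2.1⟩ : Σ i, Fin (n i) → Fin 3 → Prop)) (var.left.pair var.right.right))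

theorem answer_cutsetOf (hb : PolyBdd sz n) (hn : PolyTime e sz Γ fun i => encNat (n i))
    (hd : PolyTime e sz Γ fun i => encDom (d i)) :
    PolyTime e sz Γ fun i => encAnswer (cutsetOf (d i)) := by
  classical
  have hS : PolyTime e sz Γ fun i => encSet (Finset.univ.filter fun v => d i v 1) := by
    refine ofFn hb hn ((admissible (hb.imp fun _ h x => h x.1)
      (hd.lift (fun x : Σ i, Fin (n i) => x.1) var.right) var.left (nat_const 1)
        (x := fun _ => 1)).congr fun x => ?_)
    simp [encProp]
  refine (ite (dom_allNonempty hb hn hd) (nil.pair hS) nil).congr fun i => ?_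
  unfold cutsetOf
  split_ifs
  · simp only [encAnswer]
  · rfl

theorem answer_attempt (hb : PolyBdd sz n) (hG : PolyTime e sz Γ fun i => encGraph (G i))
    (hd : PolyTime e sz Γ fun i => encDom (d i)) {a b : ∀ i, Fin (n i)}
    (ha : PolyTime e sz Γ fun i => encNat (a i)) (hb' : PolyTime e sz Γ fun i => encNat (b i)) :
    PolyTime e sz Γ fun i =>
      encAnswer (attempt (G i) (List.finRange (n i)) (d i) (a i) (b i)) := by
  have hn := size hb hG
  refine answer_cutsetOf hb hn (foldr_fin (σ := fun i => Fin (n i) → Fin 3 → Prop)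
    (fun _ => encDom) (fun i v d => greedyStep (G i) v d) hb hn
    (dom_restrict hb hn (dom_restrict hb hn hd ha (nat_const 0) (x := fun _ => 0)) hb'
      (nat_const 2) (x := fun _ => 2)) ?_)
  exact dom_greedyStep (hb.imp fun _ h x => h x.1)
    (hG.lift (fun x : Σ i, Fin (n i) × (Fin (n i) → Fin 3 → Prop) => x.1) var.right.right)
    var.right.left var.left

theorem doms_branchStep_append (hb : PolyBdd sz n)
    (hG : PolyTime e sz Γ fun i => encGraph (G i)) (hd : PolyTime e sz Γ fun i => encDom (d i))
    {v : ∀ i, Fin (n i)} (hv : PolyTime e sz Γ fun i => encNat (v i))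
    {L : ∀ i, List (Fin (n i) → Fin 3 → Prop)}
    (hL : PolyTime e sz Γ fun i => encList ((L i).map encDom)) :
    PolyTime e sz Γ fun i => encList ((branchStep (G i) (v i) (d i) ++ L i).map encDom) := by
  classical
  refine (foldr_fin (N := fun _ => 3) (σ := fun i => List (Fin (n i) → Fin 3 → Prop))
    (fun _ L => encList (L.map encDom))
    (fun i x acc => if AllNonempty (assign (G i) (d i) (v i) x)
      then assign (G i) (d i) (v i) x :: acc else acc) (.const _ 3) (nat_const 3) hL ?_).congr
    fun i => ?_
  · let π : (Σ i, Fin 3 × List (Fin (n i) → Fin 3 → Prop)) → ι := fun x => x.1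
    have hbx : PolyBdd (fun x => sz (π x)) fun x => n (π x) := hb.imp fun _ h x => h x.1
    have hGx := hG.lift (Δ := fun x : Σ i, Fin 3 × List (Fin (n i) → Fin 3 → Prop) =>
      .node (encNat x.2.1) (.node (encList (x.2.2.map encDom)) (Γ x.1))) π var.right.right
    have h := dom_assign hbx hGx (hd.lift π var.right.right) (hv.lift π var.right.right)
      (x := fun x => x.2.1) var.left
    refine (ite (dom_allNonempty hbx (size hbx hGx) h) (h.pair var.right.left)
      var.right.left).congr fun x => ?_
    simp only [π]
    split_ifs <;> rfl
  · rw [← foldr_branchStep]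

/-- The list of branches has length at most `3 ^ |X|` times a polynomial at all stages, not only at
the end, and it is computed within that time. -/
theorem doms_branches {X Y : ∀ i, Finset (Fin (n i))} {c : ℕ}
    (hY : ∀ i, ∀ S ⊆ Y i, (G i).IsIndepSet (S : Set (Fin (n i))) → S.card ≤ c)
    (hX : ∀ i, (X i).card ≤ e i) (hb : PolyBdd sz n)
    (hG : PolyTime (fun _ => 0) sz Γ fun i => encGraph (G i))
    (hXs : PolyTime (fun _ => 0) sz Γ fun i => encSet (X i))
    (hYs : PolyTime (fun _ => 0) sz Γ fun i => encSet (Y i)) :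
    (∃ Q : Polynomial ℕ, ∀ i l, (branches (G i) (X i ∪ Y i) l).length ≤ 3 ^ e i * Q.eval (sz i)) ∧
    PolyTime e sz Γ fun i => encList
      ((branches (G i) (X i ∪ Y i) (List.finRange (n i))).map encDom) := by
  classical
  have hlen : ∃ Q : Polynomial ℕ, ∀ i l,
      (branches (G i) (X i ∪ Y i) l).length ≤ 3 ^ e i * Q.eval (sz i) := by
    obtain ⟨P, hP⟩ := hb
    refine ⟨(P + 1) ^ c * (P + 1) ^ c, fun i l => ?_⟩
    refine (length_branches_le (Y := (Y i : Set (Fin (n i))))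
      (fun S hS => hY i S (by exact_mod_cast hS)) l).trans ?_
    simp only [Polynomial.eval_mul, Polynomial.eval_pow, Polynomial.eval_add, Polynomial.eval_one,
      Fintype.card_fin]
    have := hP i
    have := hX i
    gcongr
    norm_num
  refine ⟨hlen, ?_⟩
  have h0 : ∀ i, 0 ≤ e i := fun i => Nat.zero_le _
  refine (down_loop (fun i k => encList ((branches (G i) (X i ∪ Y i)
    ((List.finRange (n i)).drop k)).map encDom)) hb ((size hb hG).mono h0) ?_ ?_).congr
    fun i => by simp
  · -- before the first step there is one branch, in which all labels are admissible
    refine PolyTime.congr (a := fun i => .node (encDom fun (_ : Fin (n i)) (_ : Fin 3) => True) .nil)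
      (PolyTime.pair (dom_mk hb ((size hb hG).mono h0) tt) nil) fun i => ?_
    rw [List.drop_eq_nil_of_le (by simp)]
    rfl
  · let π : (Σ i, Fin (n i)) → ι := fun x => x.1
    have hbx : PolyBdd (fun x => sz (π x)) fun x => n (π x) := hb.imp fun _ h x => h x.1
    have hmem : PolyTime (fun x => e (π x)) (fun x => sz (π x))
        (fun x => .node (encNat x.2) (.node (encList ((branches (G x.1) (X x.1 ∪ Y x.1)
          ((List.finRange (n x.1)).drop (x.2 + 1))).map encDom)) (Γ x.1)))
        (fun x => encProp (x.2 ∈ X x.1 ∨ x.2 ∈ Y x.1)) :=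
      prop_or (mem hbx ((hXs.mono h0).lift π var.right.right) var.left)
        (mem hbx ((hYs.mono h0).lift π var.right.right) var.left)
    refine (ite hmem (foldl_list (α := fun x => Fin (n x.1) → Fin 3 → Prop)
      (σ := fun x => List (Fin (n x.1) → Fin 3 → Prop)) (fun _ => encDom)
      (fun _ L => encList (L.map encDom)) (fun x acc d => branchStep (G x.1) x.2 d ++ acc)
      (l := fun x => branches (G x.1) (X x.1 ∪ Y x.1) ((List.finRange (n x.1)).drop (x.2 + 1)))
      (s₀ := fun _ => []) (e₁ := fun x => e x.1) (e₂ := fun _ => 0)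
      (hlen.imp fun _ h x => h x.1 _) (fun _ => le_rfl) var.right.left nil ?_)
      var.right.left).congr fun x => ?_
    · let ρ : (Σ x : (Σ i, Fin (n i)), (Fin (n x.1) → Fin 3 → Prop) ×
        List (Fin (n x.1) → Fin 3 → Prop)) → ι := fun x => x.1.1
      exact doms_branchStep_append (hb.imp fun _ h x => h (ρ x))
        (hG.lift ρ var.right.right.right.right) var.left (v := fun x => x.1.2)
        var.right.right.left var.right.left
    · obtain ⟨i, v⟩ := x
      simp only
      rw [List.drop_eq_getElem_cons (l := List.finRange (n i)) (i := v) (by simp),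
        List.getElem_finRange]
      simp only [branches, List.foldr_cons, Fin.eta, Fin.cast_mk]
      rw [foldl_branchStep]
      by_cases hv : v ∈ X i ∨ v ∈ Y i
      · rw [if_pos hv, if_pos (by simpa using hv)]
      · rw [if_neg hv, if_neg (by simpa using hv)]
        rfl

theorem answer_search {X Y : ∀ i, Finset (Fin (n i))} {c : ℕ}
    (hY : ∀ i, ∀ S ⊆ Y i, (G i).IsIndepSet (S : Set (Fin (n i))) → S.card ≤ c)
    (hX : ∀ i, (X i).card ≤ e i) (hb : PolyBdd sz n)
    (hG : PolyTime (fun _ => 0) sz Γ fun i => encGraph (G i))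
    (hXs : PolyTime (fun _ => 0) sz Γ fun i => encSet (X i))
    (hYs : PolyTime (fun _ => 0) sz Γ fun i => encSet (Y i)) :
    PolyTime e sz Γ fun i => encAnswer (search (G i) (X i ∪ Y i) (List.finRange (n i))) := by
  obtain ⟨hlen, hbr⟩ := doms_branches hY hX hb hG hXs hYs
  refine findSome_list (hlen.imp fun _ h i => h i _) hbr ?_
  have hn := (size hb hG).lift (Δ := fun x : Σ i, Fin (n i) → Fin 3 → Prop =>
    .node (encDom x.2) (Γ x.1)) (fun x => x.1) var.right
  refine findSome_fin (n := fun x : Σ i, Fin (n i) → Fin 3 → Prop => n x.1)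
    (f := fun x a => (List.finRange (n x.1)).findSome? fun b =>
      attempt (G x.1) (List.finRange (n x.1)) x.2 a b) (hb.imp fun _ h x => h x.1) hn ?_
  refine findSome_fin (n := fun x : Σ y : (Σ i, Fin (n i) → Fin 3 → Prop), Fin (n y.1) => n x.1.1)
    (f := fun x b => attempt (G x.1.1) (List.finRange (n x.1.1)) x.1.2 x.2 b)
    (hb.imp fun _ h x => h x.1.1)
    (hn.lift (fun x : Σ y : (Σ i, Fin (n i) → Fin 3 → Prop), Fin (n y.1) => x.1) var.right) ?_
  let ρ : (Σ x : (Σ y : (Σ i, Fin (n i) → Fin 3 → Prop), Fin (n y.1)), Fin (n x.1.1)) → ι :=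
    fun x => x.1.1.1
  refine answer_attempt (d := fun x => x.1.1.2) (a := fun x => x.1.2) (b := fun x => x.2)
    (hb.imp fun _ h x => h (ρ x)) ?_ ?_ ?_ ?_
  · exact hG.lift ρ var.right.right.right
  · exact var.right.right.left
  · exact var.right.left
  · exact var.left

end PolyTime

/-! ### Deleting a vertex set -/

section Deletion

variable {n : ℕ}

/-- The vertices outside `X` in increasing order. -/
def remaining (X : Finset (Fin n)) : List (Fin n) :=
  (List.finRange n).filter (· ∉ X)

theorem mem_remaining {X : Finset (Fin n)} {v : Fin n} : v ∈ remaining X ↔ v ∉ X := by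
  simp [remaining]

theorem nodup_remaining (X : Finset (Fin n)) : (remaining X).Nodup :=
  (List.nodup_finRange n).filter _

theorem length_remaining_le (X : Finset (Fin n)) : (remaining X).length ≤ n :=
  (List.length_filter_le _ _).trans (by simp)

theorem foldr_remaining (X : Finset (Fin n)) :
    (List.finRange n).foldr (fun v l => if v ∈ X then l else v :: l) [] = remaining X := by
  unfold remaining
  induction List.finRange n with
  | nil => rfl
  | cons v l ih =>
    rw [List.foldr_cons, ih, List.filter_cons]
    by_cases h : v ∈ X <;> simp [h]

/-- The graph `G - X` with its vertices renumbered. -/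
def deleted (G : SimpleGraph (Fin n)) (X : Finset (Fin n)) :
    SimpleGraph (Fin (remaining X).length) :=
  G.comap (remaining X).get

/-- The set of original vertices that corresponds to a set of vertices of `deleted G X`. -/
def original (X : Finset (Fin n)) (Y : Finset (Fin (remaining X).length)) : Finset (Fin n) :=
  Y.image (remaining X).get

theorem nonempty_iso_deleted (G : SimpleGraph (Fin n)) (X : Finset (Fin n)) :
    Nonempty (G.induce ((X : Set (Fin n))ᶜ) ≃g deleted G X) := by
  refine ⟨SimpleGraph.Iso.symm ⟨Equiv.ofBijective
    (fun a => ⟨(remaining X).get a, mem_remaining.1 (List.get_mem _ _)⟩) ⟨?_, ?_⟩, ?_⟩⟩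
  · intro a b h
    exact (nodup_remaining X).injective_get (congrArg Subtype.val h)
  · rintro ⟨v, hv⟩
    obtain ⟨a, ha⟩ := List.get_of_mem (mem_remaining.2 hv)
    exact ⟨a, Subtype.ext ha⟩
  · rfl

theorem isDominatingSet_union_original {G : SimpleGraph (Fin n)} {X : Finset (Fin n)}
    {Y : Finset (Fin (remaining X).length)} (hY : IsDominatingSet (deleted G X) (Y : Set _)) :
    IsDominatingSet G ((X : Set (Fin n)) ∪ original X Y) := by
  intro v
  by_cases hv : v ∈ X
  · exact .inl (.inl hv)
  obtain ⟨a, rfl⟩ := List.get_of_mem (mem_remaining.2 hv)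
  rcases hY a with ha | ⟨b, hb, hadj⟩
  · exact .inl (.inr (Finset.mem_image_of_mem _ ha))
  · exact .inr ⟨_, .inr (Finset.mem_image_of_mem _ hb), hadj⟩

theorem card_le_of_subset_original {G : SimpleGraph (Fin n)} {X : Finset (Fin n)}
    {Y : Finset (Fin (remaining X).length)} {c : ℕ}
    (hY : ((deleted G X).induce (Y : Set _)).indepNum ≤ c) {S : Finset (Fin n)}
    (hS : S ⊆ original X Y) (hi : G.IsIndepSet (S : Set (Fin n))) : S.card ≤ c := by
  obtain ⟨T, hT, rfl⟩ := Finset.subset_image_iff.1 hS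
  have hinj := (nodup_remaining X).injective_get
  rw [Finset.card_image_of_injective _ hinj]
  refine card_le_of_indepNum_induce_le hY hT fun a ha b hb hab => ?_
  exact hi (Finset.mem_coe.2 (Finset.mem_image_of_mem _ ha))
    (Finset.mem_coe.2 (Finset.mem_image_of_mem _ hb)) (hinj.ne hab)

end Deletion

namespace PolyTime

variable {ι : Type} {e sz : ι → ℕ} {Γ : ι → Val} {n : ι → ℕ}
  {G : ∀ i, SimpleGraph (Fin (n i))} {X : ∀ i, Finset (Fin (n i))}

theorem list_remaining (hb : PolyBdd sz n) (hn : PolyTime e sz Γ fun i => encNat (n i))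
    (hX : PolyTime e sz Γ fun i => encSet (X i)) :
    PolyTime e sz Γ fun i =>
      encList (List.ofFn fun a => encNat ((remaining (X i)).get a : ℕ)) := by
  refine (foldr_fin (σ := fun i => List (Fin (n i)))
    (fun i l => encList (l.map fun v : Fin (n i) => encNat v))
    (fun i v l => if v ∈ X i then l else v :: l) (s₀ := fun _ => []) hb hn nil ?_).congr
    fun i => ?_
  · refine (ite (mem (hb.imp fun _ h x => h x.1)
      (hX.lift (fun x : Σ i, Fin (n i) × List (Fin (n i)) => x.1) var.right.right) var.left)
      var.right.left (var.left.pair var.right.left)).congr fun x => ?_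
    by_cases h : x.2.1 ∈ X x.1 <;> simp only [h, if_true, if_false] <;> rfl
  · rw [foldr_remaining]
    congr 1
    conv_rhs => rw [← List.ofFn_get (remaining (X i)), List.map_ofFn]
    rfl

theorem bdd_remaining (hb : PolyBdd sz n) : PolyBdd sz fun i => (remaining (X i)).length :=
  hb.imp fun _ h i => (length_remaining_le _).trans (h i)

theorem length_remaining (hb : PolyBdd sz n) (hn : PolyTime e sz Γ fun i => encNat (n i))
    (hX : PolyTime e sz Γ fun i => encSet (X i)) :
    PolyTime e sz Γ fun i => encNat (remaining (X i)).length :=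
  (length (by simpa using bdd_remaining hb) (list_remaining hb hn hX)).congr fun i => by simp

theorem graph_deleted (hb : PolyBdd sz n) (hG : PolyTime e sz Γ fun i => encGraph (G i))
    (hX : PolyTime e sz Γ fun i => encSet (X i)) :
    PolyTime e sz Γ fun i => encGraph (deleted (G i) (X i)) := by
  have hn := size hb hG
  have hr := bdd_remaining (X := X) hb
  have hm := length_remaining hb hn hX
  let m : ι → ℕ := fun i => (remaining (X i)).length
  let ρ : (Σ x : (Σ i, Fin (m i)), Fin (m x.1)) → ι := fun x => x.1.1
  have hl := (list_remaining hb hn hX).lift (Δ := fun x => .node (encNat x.2)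
    (.node (encNat x.1.2) (Γ (ρ x)))) ρ var.right.right
  have hrρ : PolyBdd (fun x => sz (ρ x)) fun x => m (ρ x) := hr.imp fun _ h x => h (ρ x)
  refine ofFn hr hm (ofFn (N := fun x : Σ i, Fin (m i) => m x.1) (hr.imp fun _ h x => h x.1)
    (hm.lift (fun x : Σ i, Fin (m i) => x.1) var.right) ?_)
  exact adj (G := fun x => G (ρ x)) (hb.imp fun _ h x => h (ρ x)) (hG.lift ρ var.right.right)
    (u := fun x => (remaining (X (ρ x))).get x.1.2) (v := fun x => (remaining (X (ρ x))).get x.2)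
    (get_ofFn (N := fun x => m (ρ x)) (k := fun x => x.1.2) hrρ hl var.right.left)
    (get_ofFn (N := fun x => m (ρ x)) (k := fun x => x.2) hrρ hl var.left)

theorem set_original (hb : PolyBdd sz n) (hG : PolyTime e sz Γ fun i => encGraph (G i))
    (hX : PolyTime e sz Γ fun i => encSet (X i)) {Y : ∀ i, Finset (Fin (remaining (X i)).length)}
    (hY : PolyTime e sz Γ fun i => encSet (Y i)) :
    PolyTime e sz Γ fun i => encSet (original (X i) (Y i)) := by
  have hn := size hb hG
  have hr := bdd_remaining (X := X) hb
  have hm := length_remaining hb hn hX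
  let m : ι → ℕ := fun i => (remaining (X i)).length
  let ρ : (Σ x : (Σ i, Fin (n i)), Fin (m x.1)) → ι := fun x => x.1.1
  have hl := (list_remaining hb hn hX).lift (Δ := fun x => .node (encNat x.2)
    (.node (encNat x.1.2) (Γ (ρ x)))) ρ var.right.right
  have hrρ : PolyBdd (fun x => sz (ρ x)) fun x => m (ρ x) := hr.imp fun _ h x => h (ρ x)
  refine (ofFn (g := fun i v => encProp (∃ a, a ∈ Y i ∧ (remaining (X i)).get a = v)) hb hn
    (prop_exists (N := fun x : Σ i, Fin (n i) => m x.1) (hr.imp fun _ h x => h x.1)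
    (hm.lift (fun x : Σ i, Fin (n i) => x.1) var.right) (prop_and ?_ ?_))).congr fun i => ?_
  · exact mem (n := fun x => m (ρ x)) hrρ (hY.lift ρ var.right.right) var.left
  · exact fin_eq (N := fun x => n (ρ x)) (hb.imp fun _ h x => h (ρ x))
      (k := fun x => (remaining (X (ρ x))).get x.2) (m := fun x => x.1.2)
      (get_ofFn (N := fun x => m (ρ x)) (k := fun x => x.2) hrρ hl var.left) var.right.left
  · rw [encSet_eq]
    simp only [original, Finset.mem_image]

end PolyTime

/-! ### The algorithm -/

theorem GraphClass.Contains.mem_deleted {𝒢 : GraphClass} {n : ℕ} {G : SimpleGraph (Fin n)}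
    {X : Finset (Fin n)} (h : 𝒢.Contains (G.induce ((X : Set (Fin n))ᶜ))) :
    𝒢.mem _ (deleted G X) := by
  obtain ⟨m, H, hH, ⟨i⟩⟩ := h
  obtain ⟨j⟩ := nonempty_iso_deleted G X
  exact 𝒢.iso_closed H _ ⟨i.symm.trans j⟩ hH

theorem Run.pos {p : Prog} {v w : Val} {t : ℕ} (h : Run p v w t) : 0 < t := by
  cases h <;> omega

/-- Instances with a given deletion set: a graph `G` and a vertex set `X` with `G - X` in `𝒢`. -/
abbrev DeletionInstance (𝒢 : GraphClass) : Type :=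
  { x : Σ n, SimpleGraph (Fin n) × Finset (Fin n) //
    𝒢.Contains (x.2.1.induce ((x.2.2 : Set (Fin x.1))ᶜ)) }

/-- Once a deletion set `X` is known, a correct answer is found in time `3 ^ |X|` times a
polynomial. -/
theorem exists_correctAnswer_polyTime {c : ℕ} {𝒢 : GraphClass}
    (h𝒢 : 𝒢.EfficientlyAlphaDominated c) :
    ∃ o : ∀ i : DeletionInstance 𝒢, Option (Finset (Fin i.1.1)),
      (∀ i, IsCorrectAnswer i.1.2.1 (o i)) ∧
      PolyTime (fun i : DeletionInstance 𝒢 => i.1.2.2.card) (fun i => i.1.1)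
        (fun i => .node (encGraph i.1.2.1) (encSet i.1.2.2)) (fun i => encAnswer (o i)) := by
  obtain ⟨D, p, hD⟩ := h𝒢
  choose Z t hZ hrun ht using hD
  have hDT : PolyTime (ι := { x : Σ n, SimpleGraph (Fin n) // 𝒢.mem x.1 x.2 }) (fun _ => 0)
      (fun x => x.1.1) (fun x => encGraph x.1.2) (fun x => encSet (Z x.1.1 x.1.2 x.2)) :=
    ⟨D, p, fun x => ⟨_, hrun _ _ x.2, by simpa using ht _ _ x.2⟩⟩
  let Γ : DeletionInstance 𝒢 → Val := fun i => .node (encGraph i.1.2.1) (encSet i.1.2.2)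
  have hb : PolyBdd (fun i : DeletionInstance 𝒢 => i.1.1) fun i => i.1.1 := .of_le fun _ => le_rfl
  have hG : PolyTime (fun _ => 0) (fun i : DeletionInstance 𝒢 => i.1.1) Γ
    fun i => encGraph i.1.2.1 := PolyTime.var.left
  have hX : PolyTime (fun _ => 0) (fun i : DeletionInstance 𝒢 => i.1.1) Γ
    fun i => encSet i.1.2.2 := PolyTime.var.right
  let φ : DeletionInstance 𝒢 → { x : Σ n, SimpleGraph (Fin n) // 𝒢.mem x.1 x.2 } :=
    fun i => ⟨⟨_, deleted i.1.2.1 i.1.2.2⟩, i.2.mem_deleted⟩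
  have hZφ := hDT.comp φ (fun _ => le_rfl) (PolyTime.bdd_remaining hb)
    (PolyTime.graph_deleted hb hG hX)
  have hY := PolyTime.set_original hb hG hX hZφ
  have hα := fun i : DeletionInstance 𝒢 => hZ _ _ (φ i).2
  refine ⟨_, fun i => ?_, PolyTime.answer_search (c := c)
    (fun i S hS hi => card_le_of_subset_original (hα i).2 hS hi) (fun _ => le_rfl) hb hG hX hY⟩
  cases hs : search i.1.2.1 (i.1.2.2 ∪ original i.1.2.2 (Z _ _ (φ i).2)) (List.finRange i.1.1) with
  | none =>
    rintro ⟨S, hS⟩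
    exact not_isIndepCutset_of_search (isDominatingSet_union_original (hα i).1)
      List.mem_finRange hs S hS
  | some S => exact isIndepCutset_of_search List.mem_finRange hs

theorem exists_run_encGraph {inp : Presentation} (h : inp = graphOnly ∨ inp = graphAndParam) :
    ∃ q : Prog, ∀ (n : ℕ) (G : SimpleGraph (Fin n)) (k : ℕ), Run q (inp n G k) (encGraph G) 1 := by
  rcases h with rfl | rfl
  · exact ⟨.skip, fun _ _ _ => .skip _⟩
  · exact ⟨.left, fun _ _ _ => .left _⟩

theorem indepCutsetSolved_of_deletionSetFound {c : ℕ} {𝒢 : GraphClass}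
    (h𝒢 : 𝒢.EfficientlyAlphaDominated c) {inp : Presentation}
    (hinp : inp = graphOnly ∨ inp = graphAndParam)
    {I : ∀ n : ℕ, SimpleGraph (Fin n) → ℕ → Prop} {f : ℕ → ℝ} (h : DeletionSetFound inp I 𝒢 f) :
    IndepCutsetSolved inp I (fun k => f k + 3 ^ k) := by
  obtain ⟨o, ho, B, P, hB⟩ := exists_correctAnswer_polyTime h𝒢
  obtain ⟨q, hq⟩ := exists_run_encGraph hinp
  obtain ⟨A, p, hA⟩ := h
  refine ⟨.seq (.cons q A) B, p + P + 3, fun n G k hI => ?_⟩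
  obtain ⟨X, s, hXk, hX, hrun, hs⟩ := hA n G k hI
  let i : DeletionInstance 𝒢 := ⟨⟨n, G, X⟩, hX⟩
  obtain ⟨t, hrun', ht⟩ := hB i
  refine ⟨o i, _, ho i, .seq (.cons (hq n G k) hrun) hrun', ?_⟩
  have hs0 : (0 : ℝ) < s := by exact_mod_cast hrun.pos
  -- the time of a run is positive, hence so is `f k`
  have hf : 0 < f k := pos_of_mul_pos_left (hs0.trans_le hs) (Nat.cast_nonneg _)
  have ht' : (t : ℝ) ≤ 3 ^ k * (P.eval n : ℕ) := by
    have : t ≤ 3 ^ k * P.eval n :=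
      ht.trans (Nat.mul_le_mul_right _ (Nat.pow_le_pow_right (by norm_num) hXk))
    exact_mod_cast this
  have h1 : (1 : ℝ) ≤ 3 ^ k := one_le_pow₀ (by norm_num)
  have hp : (0 : ℝ) ≤ (p.eval n : ℕ) := Nat.cast_nonneg _
  have hP : (0 : ℝ) ≤ (P.eval n : ℕ) := Nat.cast_nonneg _
  have h2 := mul_nonneg hf.le hP
  have h3 := mul_nonneg (zero_le_one.trans h1) hp
  simp only [Polynomial.eval_add, Polynomial.eval_ofNat]
  push_cast
  nlinarith

/-- The second part is the case of the parameter value `0`, where the deletion set is empty. -/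
theorem indepCutsetPolyTimeOn {c : ℕ} {𝒢 : GraphClass} (h𝒢 : 𝒢.EfficientlyAlphaDominated c) :
    IndepCutsetPolyTimeOn 𝒢 := by
  let I : ∀ n : ℕ, SimpleGraph (Fin n) → ℕ → Prop := fun n G k => 𝒢.mem n G ∧ k = 0
  have hdel : DeletionSetFound graphOnly I 𝒢 fun _ => 1 := by
    obtain ⟨A, p, hA⟩ : PolyTime (ι := Σ n, SimpleGraph (Fin n)) (fun _ => 0) (fun x => x.1)
        (fun x => encGraph x.2) (fun x => encSet (∅ : Finset (Fin x.1))) := by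
      have hb : PolyBdd (fun x : Σ n, SimpleGraph (Fin n) => x.1) fun x => x.1 :=
        .of_le fun _ => le_rfl
      exact (PolyTime.ofFn (g := fun _ _ => encProp False) hb (PolyTime.size hb .var)
        PolyTime.ff).congr fun x => by simp [encSet_eq]
    refine ⟨A, p, fun n G k hI => ?_⟩
    obtain ⟨t, hrun, ht⟩ := hA ⟨n, G⟩
    refine ⟨∅, t, by simp, ⟨n, G, hI.1, ?_⟩, hrun, ?_⟩
    · rw [Finset.coe_empty, Set.compl_empty]
      exact ⟨SimpleGraph.induceUnivIso G⟩
    · simp only [pow_zero, one_mul] at ht ⊢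
      exact_mod_cast ht
  obtain ⟨B, p, hB⟩ := indepCutsetSolved_of_deletionSetFound h𝒢 (.inl rfl) hdel
  refine ⟨B, 2 * p, fun n G hG _ => ?_⟩
  obtain ⟨o, t, ho, hrun, ht⟩ := hB n G 0 ⟨hG, rfl⟩
  refine ⟨o, t, ho, hrun, ?_⟩
  rw [Polynomial.eval_mul, Polynomial.eval_ofNat]
  norm_num at ht
  exact_mod_cast ht

end ICut

theorem mainTheorem11 (c : ℕ) (𝒢 : ICut.GraphClass) (h𝒢 : 𝒢.EfficientlyAlphaDominated c) :
    (∀ (inp : ICut.Presentation), inp = ICut.graphOnly ∨ inp = ICut.graphAndParam →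
      ∀ (I : ∀ n : ℕ, SimpleGraph (Fin n) → ℕ → Prop),
        (∀ (n : ℕ) (G : SimpleGraph (Fin n)) (k : ℕ), I n G k → G.Connected) →
      ∀ (f : ℕ → ℝ), ICut.DeletionSetFound inp I 𝒢 f →
        ICut.IndepCutsetSolved inp I (fun k => f k + 3 ^ k)) ∧
    ICut.IndepCutsetPolyTimeOn 𝒢 :=
  ⟨fun _ hinp _ _ _ h => ICut.indepCutsetSolved_of_deletionSetFound h𝒢 hinp h,
    ICut.indepCutsetPolyTimeOn h𝒢⟩
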